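/- Let $k$ be an algebraically closed field of arbitrary characteristic, let $X$ be a smooth variety over $k$ (an integral separated scheme of finite type over $k$, smooth over $k$) of dimension $n$, let $L$ be a line bundle on $X$, and let $\ell \ge 0$ be an integer. Let $p, q \colon X \times_k X \to X$ be the two projections, let $\mathscr{I} \subset \mathcal{O}_{X \times_k X}$ be the ideal sheaf of the diagonal, and let \[ \mathscr{P}^\ell(L) := p_*\bigl(q^*L \otimes \mathcal{O}_{X \times_k X}/\mathscr{I}^{\ell+1}\bigr) \] be the $\ell$th bundle of principal parts of $L$. Let $\Omega_X$ be the sheaf of differentials of $X$ over $k$, and let $\omega_X = \bigwedge^n \Omega_X$. Then $\mathscr{P}^\ell(L)$ is a vector bundle of rank $\binom{n+\ell}{n}$, and its determinant (top exterior power) satisfies \[ \det\bigl(\mathscr{P}^\ell(L)\bigr) \cong \bigl(\omega_X^{\ell} \otimes L^{n+1}\bigr)^{\frac{1}{n+1}\binom{n+\ell}{n}}, \] where the right-hand side denotes $\omega_X^{\otimes a} \otimes L^{\otimes \binom{n+\ell}{n}}$ with $a = \frac{\ell}{n+1}\binom{n+\ell}{n}$, which is an integer. -/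

import Mathlib

open CategoryTheory AlgebraicGeometry

universe u

noncomputable section

namespace PresheafOfModules

variable {C : Type*} [Category* C] {R : Cᵒᵖ ⥤ CommRingCat.{u}}
  (M : PresheafOfModules.{u} (R ⋙ forget₂ CommRingCat RingCat)) (r : ℕ)

/-- The sections of `M` over `U`, as an object of the category of `R(U)`-modules. -/
def sectionsModule (U : Cᵒᵖ) : ModuleCat.{u} (R.obj U) := M.obj U

/-- The restriction map `M(U) → M(V)`. -/
def res {U V : Cᵒᵖ} (g : U ⟶ V) (m : M.sectionsModule U) : M.sectionsModule V := M.map g m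

lemma res_add {U V : Cᵒᵖ} (g : U ⟶ V) (x y : M.sectionsModule U) :
    M.res g (x + y) = M.res g x + M.res g y :=
  map_add (M.map g).hom x y

lemma res_smul {U V : Cᵒᵖ} (g : U ⟶ V) (c : R.obj U) (x : M.sectionsModule U) :
    M.res g (c • x) = R.map g c • M.res g x :=
  M.map_smul g c x

lemma res_id (U : Cᵒᵖ) (x : M.sectionsModule U) : M.res (𝟙 U) x = x := by
  change M.map (𝟙 U) x = x
  rw [M.map_id]
  rfl

lemma res_comp {U V W : Cᵒᵖ} (g : U ⟶ V) (h : V ⟶ W) (x : M.sectionsModule U) :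
    M.res (g ≫ h) x = M.res h (M.res g x) :=
  M.map_comp_apply g h x

lemma res_update {U V : Cᵒᵖ} (g : U ⟶ V) [DecidableEq (Fin r)] (m : Fin r → M.sectionsModule U)
    (i : Fin r) (x : M.sectionsModule U) :
    (fun j => M.res g (Function.update m i x j)) =
      Function.update (fun j => M.res g (m j)) i (M.res g x) :=
  Function.comp_update (M.res g) m i x

/-- The alternating map `(m₁, …, mᵣ) ↦ m₁|_V ∧ ⋯ ∧ mᵣ|_V` from `M(U)` to `⋀ʳ M(V)`. -/
def exteriorPowerRes {U V : Cᵒᵖ} (g : U ⟶ V) :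
    (M.sectionsModule U).AlternatingMap
      ((ModuleCat.restrictScalars (R.map g).hom).obj ((M.sectionsModule V).exteriorPower r)) r where
  toFun m := exteriorPower.ιMulti (R.obj V) r (fun i => M.res g (m i))
  map_update_add' m i x y := by
    rw [res_update, res_update, res_update, res_add]
    exact (exteriorPower.ιMulti (R.obj V) r (M := M.sectionsModule V)).map_update_add _ i _ _
  map_update_smul' m i c x := by
    rw [res_update, res_update, res_smul]
    exact (exteriorPower.ιMulti (R.obj V) r (M := M.sectionsModule V)).map_update_smul _ i _ _
  map_eq_zero_of_eq' m i j h hij :=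
    (exteriorPower.ιMulti (R.obj V) r (M := M.sectionsModule V)).map_eq_zero_of_eq _
      (congrArg (M.res g) h) hij

/-- The restriction map `⋀ʳ M(U) → ⋀ʳ M(V)`, `m₁ ∧ ⋯ ∧ mᵣ ↦ m₁|_V ∧ ⋯ ∧ mᵣ|_V`, of exterior
powers over `R(U)` and `R(V)`. -/
def exteriorPowerMap {U V : Cᵒᵖ} (g : U ⟶ V) :
    (M.sectionsModule U).exteriorPower r ⟶
      (ModuleCat.restrictScalars (R.map g).hom).obj ((M.sectionsModule V).exteriorPower r) :=
  ModuleCat.exteriorPower.desc (M.exteriorPowerRes r g)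

lemma exteriorPowerMap_mk {U V : Cᵒᵖ} (g : U ⟶ V) (m : Fin r → M.sectionsModule U) :
    (M.exteriorPowerMap r g).hom (ModuleCat.exteriorPower.mk m) =
      (ModuleCat.exteriorPower.mk (M := M.sectionsModule V) fun i => M.res g (m i)) :=
  ModuleCat.exteriorPower.desc_mk (M.exteriorPowerRes r g) m

/-- The presheaf of modules `U ↦ ⋀ʳ M(U)`. -/
def exteriorPower : PresheafOfModules.{u} (R ⋙ forget₂ CommRingCat RingCat) where
  obj U := (M.sectionsModule U).exteriorPower r
  map g := M.exteriorPowerMap r g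
  map_id U := by
    refine ModuleCat.exteriorPower.hom_ext (ModuleCat.AlternatingMap.ext fun m => ?_)
    refine (M.exteriorPowerMap_mk r (𝟙 U) m).trans ?_
    simp only [res_id]
    rfl
  map_comp f g := by
    refine ModuleCat.exteriorPower.hom_ext (ModuleCat.AlternatingMap.ext fun m => ?_)
    refine (M.exteriorPowerMap_mk r (f ≫ g) m).trans ?_
    simp only [res_comp]
    refine (M.exteriorPowerMap_mk r g _).symm.trans ?_
    exact congrArg (M.exteriorPowerMap r g).hom (M.exteriorPowerMap_mk r f m).symm

end PresheafOfModules

namespace AlgebraicGeometry.Scheme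

namespace Modules

variable {X : Scheme.{u}}

/-- The `𝒪_X`-module associated with a presheaf of `𝒪_X`-modules. -/
def ofPresheaf (M : _root_.PresheafOfModules.{u} (X.presheaf ⋙ forget₂ CommRingCat RingCat)) :
    X.Modules :=
  (PresheafOfModules.sheafification (𝟙 X.ringCatSheaf.obj)).obj M

/-- The structure sheaf `𝒪_X`, as an `𝒪_X`-module. -/
def structureSheaf (X : Scheme.{u}) : X.Modules :=
  SheafOfModules.unit X.ringCatSheaf

/-- The free `𝒪_X`-module `𝒪_X^r`. -/
def freeOfRank (X : Scheme.{u}) (r : ℕ) : X.Modules :=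
  SheafOfModules.free (R := X.ringCatSheaf) (ULift.{u} (Fin r))

/-- The tensor product `M ⊗ N` over `𝒪_X`: the sheaf associated with
`U ↦ M(U) ⊗ N(U)` (tensor product over `𝒪_X(U)`). -/
def tensor (M N : X.Modules) : X.Modules :=
  ofPresheaf (PresheafOfModules.Monoidal.tensorObj (R := X.presheaf) M.val N.val)

/-- The tensor powers `M^{⊗ m}`, with `M^{⊗ 0} = 𝒪_X`. -/
def tensorPower (M : X.Modules) : ℕ → X.Modules
  | 0 => structureSheaf X
  | m + 1 => tensor (tensorPower M m) M

/-- The exterior power `⋀ʳ M` over `𝒪_X`: the sheaf associated with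
`U ↦ ⋀ʳ M(U)` (exterior power over `𝒪_X(U)`). -/
def exteriorPower (M : X.Modules) (r : ℕ) : X.Modules :=
  ofPresheaf (PresheafOfModules.exteriorPower (R := X.presheaf) M.val r)

/-- `M` is a vector bundle of rank `r`: every point has an open neighbourhood `U` with
`M|_U ≅ 𝒪_U^r`. -/
def IsLocallyFreeOfRank (M : X.Modules) (r : ℕ) : Prop :=
  ∀ x : X, ∃ U : X.Opens, x ∈ U ∧ Nonempty (M.restrict U.ι ≅ freeOfRank U.toScheme r)

/-- A line bundle. -/
def IsLineBundle (L : X.Modules) : Prop := L.IsLocallyFreeOfRank 1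

/-- The determinant of a vector bundle of rank `r` is its top exterior power. -/
def det (M : X.Modules) {r : ℕ} (_ : M.IsLocallyFreeOfRank r) : X.Modules :=
  M.exteriorPower r

end Modules

variable {X : Scheme.{u}}

/-- The quotient `𝒪_X / I` of the structure sheaf by a quasi-coherent ideal sheaf `I`:
the direct image of the structure sheaf of the closed subscheme defined by `I`. -/
def IdealSheafData.quotient (I : X.IdealSheafData) : X.Modules :=
  (Modules.pushforward I.subschemeι).obj (Modules.structureSheaf I.subscheme)

variable {k : Type u} [Field k] (f : X ⟶ Spec (CommRingCat.of k))

/-- The structure maps `k → 𝒪_X(U)` of a `k`-scheme `X`, for all open `U`. -/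
def structureMap : (Functor.const X.Opensᵒᵖ).obj (CommRingCat.of k) ⟶ X.presheaf where
  app U := (Scheme.ΓSpecIso (CommRingCat.of k)).inv ≫ f.appTop ≫
    X.presheaf.map (homOfLE le_top : U.unop ⟶ ⊤).op
  naturality U V g := by
    simp only [Functor.const_obj_obj, Functor.const_obj_map, Category.id_comp, Category.assoc,
      ← Functor.map_comp]
    rfl

/-- The cotangent sheaf `Ω_X` of a `k`-scheme `X`: the sheaf associated with
`U ↦ Ω_{𝒪_X(U)/k}`. -/
def cotangentSheaf : X.Modules :=
  Modules.ofPresheaf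
    (PresheafOfModules.DifferentialsConstruction.relativeDifferentials' (structureMap (k := k) f))

/-- For `X` smooth of dimension `n` over `k`, the canonical bundle `ω_X = ⋀ⁿ Ω_X`. -/
def canonicalSheaf (n : ℕ) : X.Modules := (cotangentSheaf f).exteriorPower n

/-- The ideal sheaf of the diagonal in `X ×ₖ X`. -/
def diagonalIdeal : (Limits.pullback f f).IdealSheafData := (Limits.pullback.diagonal f).ker

/-- The sheaf of principal parts `𝒫^ℓ(L) = p_*(q^*L ⊗ 𝒪_{X × X} / I^{ℓ+1})`, where `p` and `q` are
the first and the second projection of `X ×ₖ X` and `I` is the ideal sheaf of the diagonal. -/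
def principalParts (l : ℕ) (L : X.Modules) : X.Modules :=
  (Modules.pushforward (Limits.pullback.fst f f)).obj
    (Modules.tensor ((Modules.pullback (Limits.pullback.snd f f)).obj L)
      (diagonalIdeal f ^ (l + 1)).quotient)

end AlgebraicGeometry.Scheme

end

/-! Both sides of the isomorphism are locally generated by one section, so it suffices to exhibit
generators on an open cover with the same transition functions (`nonempty_iso_of_isGeneratorOn`). No
filtration by symmetric powers is used; everything is an explicit change of basis.

Near each point choose an affine open `V`, coordinates `x` (functions whose differentials are a
basis of `Ω`) and a generator `e` of `L`. The coordinates make `𝒪(V)` étale over a polynomial ring,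
and infinitesimal lifting yields a Taylor expansion that identifies functions on `V × V` modulo the
`(l+1)`st power of the diagonal ideal with truncated polynomials in `ξ_i = q^*x_i - p^*x_i`
(`exists_taylor`). As the sheaf pushed forward by `p` lives on the diagonal, its sections over `V ×
X` are those over `V × V`. Hence the elements `q^*e ⊗ ξ^α` with `|α| ≤ l` form a basis of the
principal parts, of size `(n+l).choose n`.

For other choices `y`, `e' = g e` with `dy = G dx`, the new basis element of index `α` is `p^*g ·
∏_i (∑_j p^*G_ij ξ_j)^{α_i}` plus terms of order above `|α|`. The transition matrix is therefore
block triangular for the degree, with blocks `g · Sym^d G`, and its determinant is `g ^ (n+l).choose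
n * det G ^ (n+l).choose (n+1)` (`det_of_coeff_linProd`). The second exponent is the sum of `α_i`
over all `|α| ≤ l`. To compute the determinant in any characteristic, `G` is factored over the
fraction field into diagonal matrices and transvections.

On the other side `dx_1 ∧ ⋯ ∧ dx_n` changes by `det G` and `e` by `g`, so `ω^a ⊗ L^r` has this
transition function for `r = (n+l).choose n` and `a = (n+l).choose (n+1)`. -/

noncomputable section

open TopologicalSpace Opposite

/-! ### Local criteria for bijectivity, sheafification, and bases of sections of a module. -/

namespace TopCat.Presheaf
variable {X : TopCat.{u}}

/-- A natural family of maps between two sheaves over the opens of `U` which is locally bijective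
is bijective. -/
lemma bijective_of_locally {N M : X.Presheaf (Type u)} (hN : N.IsSheaf) (hM : M.IsSheaf)
    (U : Opens X) (ψ : ∀ V, V ≤ U → N.obj (op V) → M.obj (op V))
    (nat : ∀ (V W : Opens X) (hW : W ≤ V) (hV : V ≤ U) (n : N.obj (op V)),
      ψ W (hW.trans hV) (N.map (homOfLE hW).op n) = M.map (homOfLE hW).op (ψ V hV n))
    (inj : ∀ (V : Opens X) (hV : V ≤ U) (n n' : N.obj (op V)), ψ V hV n = ψ V hV n' →
      ∀ x ∈ V, ∃ (W : Opens X) (hW : W ≤ V), x ∈ W ∧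
        N.map (homOfLE hW).op n = N.map (homOfLE hW).op n')
    (surj : ∀ (V : Opens X) (hV : V ≤ U) (m : M.obj (op V)),
      ∀ x ∈ V, ∃ (W : Opens X) (hW : W ≤ V), x ∈ W ∧
        ∃ n, ψ W (hW.trans hV) n = M.map (homOfLE hW).op m)
    (V : Opens X) (hV : V ≤ U) : Function.Bijective (ψ V hV) := by
  have injV : ∀ (V : Opens X) (hV : V ≤ U), Function.Injective (ψ V hV) := by
    intro V hV n n' h
    choose W hW hx hn using inj V hV n n' h
    refine TopCat.Sheaf.eq_of_locally_eq' ⟨N, hN⟩ (fun x : V => W x.1 x.2) V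
      (fun x => homOfLE (hW x.1 x.2)) ?_ n n' (fun x => hn x.1 x.2)
    intro x hxV
    exact Opens.mem_iSup.2 ⟨⟨x, hxV⟩, hx x hxV⟩
  refine ⟨injV V hV, fun m => ?_⟩
  choose W hW hx n hn using surj V hV m
  have cov : V ≤ ⨆ x : V, W x.1 x.2 :=
    fun x hxV => Opens.mem_iSup.2 ⟨⟨x, hxV⟩, hx x hxV⟩
  obtain ⟨s, hs, -⟩ := TopCat.Sheaf.existsUnique_gluing' ⟨N, hN⟩ (fun x : V => W x.1 x.2) V
    (fun x => homOfLE (hW x.1 x.2)) cov (fun x => n x.1 x.2) (by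
      intro x y
      apply injV _ (inf_le_left.trans ((hW x.1 x.2).trans hV))
      refine (nat _ _ _ ((hW x.1 x.2).trans hV) _).trans
        (Eq.trans ?_ (nat _ _ _ ((hW y.1 y.2).trans hV) _).symm)
      rw [hn, hn]
      simp only [← ConcreteCategory.comp_apply, ← Functor.map_comp]
      rfl)
  refine ⟨s, TopCat.Sheaf.eq_of_locally_eq' ⟨M, hM⟩ (fun x : V => W x.1 x.2) V
    (fun x => homOfLE (hW x.1 x.2)) cov _ _ (fun x => ?_)⟩
  refine (nat V _ (hW x.1 x.2) hV s).symm.trans ((congrArg _ (hs x)).trans (hn x.1 x.2))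
end TopCat.Presheaf
namespace AlgebraicGeometry.Scheme.Modules
variable {X : Scheme.{u}}

lemma _root_.AlgebraicGeometry.Scheme.exists_isAffineOpen_mem_le {x : X} {U : X.Opens}
    (hxU : x ∈ U) : ∃ W : X.Opens, IsAffineOpen W ∧ x ∈ W ∧ W ≤ U :=
  exists_isAffineOpen_mem_and_subset hxU

/-- Restriction of functions. -/
def _root_.AlgebraicGeometry.Scheme.fres {X : Scheme.{u}} {V U : X.Opens} (h : V ≤ U) :
    Γ(X, U) →+* Γ(X, V) :=
  (X.presheaf.map (homOfLE h).op).hom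

lemma _root_.AlgebraicGeometry.Scheme.fres_self {U : X.Opens} (a : Γ(X, U)) :
    fres le_rfl a = a :=
  congr($(X.presheaf.map_id (op U)) a)

/-- Restriction of sections of a module. -/
def mres (M : X.Modules) {V U : X.Opens} (h : V ≤ U) : Γ(M, U) →+ Γ(M, V) :=
  (M.presheaf.map (homOfLE h).op).hom

lemma mres_smul (M : X.Modules) {V U : X.Opens} (h : V ≤ U) (a : Γ(X, U)) (m : Γ(M, U)) :
    M.mres h (a • m) = fres h a • M.mres h m :=
  M.map_smul (homOfLE h) a m

lemma mres_mres (M : X.Modules) {U V W : X.Opens} (h : V ≤ U) (h' : W ≤ V)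
    (m : Γ(M, U)) : M.mres h' (M.mres h m) = M.mres (h'.trans h) m :=
  congr($((M.presheaf.map_comp (homOfLE h).op (homOfLE h').op).symm) m)

lemma mres_self (M : X.Modules) {U : X.Opens} (m : Γ(M, U)) : M.mres le_rfl m = m :=
  congr($(M.presheaf.map_id (op U)) m)

lemma app_mres {M N : X.Modules} (φ : M ⟶ N) {V U : X.Opens} (h : V ≤ U) (m : Γ(M, U)) :
    φ.app V (M.mres h m) = N.mres h (φ.app U m) :=
  NatTrans.naturality_apply φ.mapPresheaf (homOfLE h).op m

lemma eq_of_locally_mres_eq (M : X.Modules) {U : X.Opens} (m n : Γ(M, U))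
    (h : ∀ x ∈ U, ∃ (V : X.Opens) (hV : V ≤ U), x ∈ V ∧ M.mres hV m = M.mres hV n) : m = n := by
  choose V hV hx hmn using h
  exact TopCat.Sheaf.eq_of_locally_eq' ⟨M.presheaf, M.isSheaf⟩ (fun x : U => V x.1 x.2) U
    (fun x => homOfLE (hV x.1 x.2)) (fun x hxU => Opens.mem_iSup.2 ⟨⟨x, hxU⟩, hx x hxU⟩) m n
    (fun x => hmn x.1 x.2)

/-- The canonical map from a presheaf of modules to the associated sheaf. -/
def toOf (P : _root_.PresheafOfModules.{u} (X.presheaf ⋙ forget₂ CommRingCat RingCat)) (V : X.Opens) :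
  P.sectionsModule (op V) →ₗ[Γ(X, V)] Γ(ofPresheaf P, V) :=
   (((PresheafOfModules.sheafificationAdjunction (𝟙 X.ringCatSheaf.obj)).unit.app P).app (op V)).hom

lemma toOf_res (P : _root_.PresheafOfModules.{u} (X.presheaf ⋙ forget₂ CommRingCat RingCat))
    {V W : X.Opens} (h : W ≤ V) (m : P.sectionsModule (op V)) :
    toOf P W (P.res (homOfLE h).op m) = (ofPresheaf P).mres h (toOf P V m) :=
  NatTrans.naturality_apply (toSheafify (Opens.grothendieckTopology X) P.presheaf)
    (homOfLE h).op m

lemma toOf_locally_injective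
    (P : _root_.PresheafOfModules.{u} (X.presheaf ⋙ forget₂ CommRingCat RingCat))
    {V : X.Opens} (m n : P.sectionsModule (op V)) (h : toOf P V m = toOf P V n) (x : X)
    (hx : x ∈ V) : ∃ (W : X.Opens) (hW : W ≤ V), x ∈ W ∧
      P.res (homOfLE hW).op m = P.res (homOfLE hW).op n := by
  obtain ⟨W, i, hi, hxW⟩ := Presheaf.equalizerSieve_mem (Opens.grothendieckTopology X)
    (toSheafify (Opens.grothendieckTopology X) P.presheaf) (X := op V) m n h x hx
  exact ⟨W, leOfHom i, hxW, hi⟩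

lemma toOf_locally_surjective
    (P : _root_.PresheafOfModules.{u} (X.presheaf ⋙ forget₂ CommRingCat RingCat))
    {V : X.Opens} (m : Γ(ofPresheaf P, V)) (x : X)
    (hx : x ∈ V) : ∃ (W : X.Opens) (hW : W ≤ V), x ∈ W ∧
      ∃ n, toOf P W n = (ofPresheaf P).mres hW m := by
  obtain ⟨W, i, ⟨n, hn⟩, hxW⟩ := Presheaf.imageSieve_mem (Opens.grothendieckTopology X)
    (toSheafify (Opens.grothendieckTopology X) P.presheaf) (U := op V) m x hx
  exact ⟨W, leOfHom i, hxW, n, hn⟩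

/-- The sheaf of sets underlying an `𝒪_X`-module. -/
def typePresheaf (M : X.Modules) : TopCat.Presheaf (Type u) X := M.presheaf ⋙ CategoryTheory.forget Ab

lemma typePresheaf_isSheaf (M : X.Modules) : M.typePresheaf.IsSheaf :=
  (TopCat.Presheaf.isSheaf_iff_isSheaf_comp (CategoryTheory.forget Ab) M.presheaf).1 M.isSheaf

/-- The sheaf of sets `V ↦ 𝒪(V)^ι`. -/
def piPresheaf (X : Scheme.{u}) (ι : Type) : TopCat.Presheaf (Type u) X where
  obj V := ι → Γ(X, V.unop)
  map g := TypeCat.ofHom (fun c i => X.presheaf.map g (c i))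
  map_id V := by ext c i; exact congr($(X.presheaf.map_id V) (c i))
  map_comp f g := by ext c i; exact congr($(X.presheaf.map_comp f g) (c i))

lemma piPresheaf_isSheaf (X : Scheme.{u}) (ι : Type) : (piPresheaf X ι).IsSheaf := by
  apply TopCat.Presheaf.isSheaf_of_isSheafUniqueGluing_types
  intro κ U sf hsf
  have := fun i => X.sheaf.existsUnique_gluing (U := U) (fun j => sf j i)
    (fun j j' => congrFun (hsf j j') i)
  choose s hs hu using this
  refine ⟨s, fun j => funext fun i => hs i j, fun t ht => funext fun i => hu i _ ?_⟩
  exact fun j => congrFun (ht j) i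

/-- A natural family of maps from a sheaf of sets to a presheaf of modules, bijective on the
affine opens contained in `U`, becomes bijective on all opens contained in `U` after
sheafification. -/
lemma toOf_comp_bijective
    (P : _root_.PresheafOfModules.{u} (X.presheaf ⋙ forget₂ CommRingCat RingCat))
    {N : TopCat.Presheaf (Type u) X} (hN : N.IsSheaf) (U : X.Opens)
    (φ : ∀ V, V ≤ U → N.obj (op V) → P.sectionsModule (op V))
    (nat : ∀ (V W : X.Opens) (hW : W ≤ V) (hV : V ≤ U) (n : N.obj (op V)),
      φ W (hW.trans hV) (N.map (homOfLE hW).op n) = P.res (homOfLE hW).op (φ V hV n))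
    (bij : ∀ (V : X.Opens) (hV : V ≤ U), IsAffineOpen V → Function.Bijective (φ V hV))
    (V : X.Opens) (hV : V ≤ U) : Function.Bijective fun n => toOf P V (φ V hV n) := by
  refine TopCat.Presheaf.bijective_of_locally hN (ofPresheaf P).typePresheaf_isSheaf U
    (fun V hV n => toOf P V (φ V hV n)) ?_ ?_ ?_ V hV
  · intro V W hW hV n
    exact (congrArg (toOf P W) (nat V W hW hV n)).trans (toOf_res P hW _)
  · intro V hV n n' h x hx
    obtain ⟨W, hW, hxW, e⟩ := toOf_locally_injective P _ _ h x hx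
    obtain ⟨W', hW', hxW', hle⟩ := exists_isAffineOpen_mem_le hxW
    refine ⟨W', le_trans hle hW, hxW', (bij W' (le_trans (le_trans hle hW) hV) hW').1 ?_⟩
    rw [nat _ _ _ hV, nat _ _ _ hV]
    have := congrArg (P.res (homOfLE hle).op) e
    rwa [← PresheafOfModules.res_comp, ← PresheafOfModules.res_comp] at this
  · intro V hV m x hx
    obtain ⟨W, hW, hxW, p, hp⟩ := toOf_locally_surjective P m x hx
    obtain ⟨W', hW', hxW', hle⟩ := exists_isAffineOpen_mem_le hxW
    obtain ⟨n, hn⟩ := (bij W' (le_trans (le_trans hle hW) hV) hW').2 (P.res (homOfLE hle).op p)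
    refine ⟨W', le_trans hle hW, hxW', n, ?_⟩
    refine (congrArg (toOf P W') hn).trans ((toOf_res P hle p).trans ?_)
    rw [hp]
    exact mres_mres _ _ _ _

/-- Affine opens form a basis of the topology, and both sides are sheaves, so bijectivity may be
tested there. Algebra on affine opens then suffices for the cotangent sheaf and the principal parts.
-/
lemma bijective_of_isAffineOpen (M : X.Modules)
    {N : TopCat.Presheaf (Type u) X} (hN : N.IsSheaf) (U : X.Opens)
    (φ : ∀ V, V ≤ U → N.obj (op V) → Γ(M, V))
    (nat : ∀ (V W : X.Opens) (hW : W ≤ V) (hV : V ≤ U) (n : N.obj (op V)),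
      φ W (hW.trans hV) (N.map (homOfLE hW).op n) = M.mres hW (φ V hV n))
    (bij : ∀ (V : X.Opens) (hV : V ≤ U), IsAffineOpen V → Function.Bijective (φ V hV))
    (V : X.Opens) (hV : V ≤ U) : Function.Bijective (φ V hV) := by
  refine TopCat.Presheaf.bijective_of_locally hN M.typePresheaf_isSheaf U φ nat ?_ ?_ V hV
  · intro V hV n n' h x hx
    obtain ⟨W', hW', hxW', hle⟩ := exists_isAffineOpen_mem_le hx
    refine ⟨W', hle, hxW', (bij W' (le_trans hle hV) hW').1 ?_⟩
    rw [nat _ _ _ hV, nat _ _ _ hV, h]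
  · intro V hV m x hx
    obtain ⟨W', hW', hxW', hle⟩ := exists_isAffineOpen_mem_le hx
    obtain ⟨n, hn⟩ := (bij W' (le_trans hle hV) hW').2 (M.mres hle m)
    exact ⟨W', hle, hxW', n, hn⟩

section Basis

variable {ι : Type} [Fintype ι]

/-- The sections `s i` of `M` over `U` form a basis of `M` over every open contained in `U`. -/
def IsBasisOn (M : X.Modules) (U : X.Opens) (s : ι → Γ(M, U)) : Prop :=
  ∀ (V : X.Opens) (hV : V ≤ U),
    Function.Bijective fun c : ι → Γ(X, V) => ∑ i, c i • M.mres hV (s i)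

lemma IsBasisOn.mres {M : X.Modules} {U : X.Opens} {s : ι → Γ(M, U)} (h : M.IsBasisOn U s)
    {V : X.Opens} (hV : V ≤ U) : M.IsBasisOn V fun i => M.mres hV (s i) := by
  intro W hW
  simpa only [mres_mres] using h W (hW.trans hV)

/-- The basis of `M(V)` given by the restrictions of `s`. -/
def IsBasisOn.basis {M : X.Modules} {U : X.Opens} {s : ι → Γ(M, U)} (h : M.IsBasisOn U s)
    {V : X.Opens} (hV : V ≤ U) : Module.Basis ι Γ(X, V) Γ(M, V) :=
  Module.Basis.ofEquivFun (LinearEquiv.ofBijective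
    (Fintype.linearCombination Γ(X, V) fun i => M.mres hV (s i)) (h V hV)).symm

lemma IsBasisOn.basis_apply {M : X.Modules} {U : X.Opens} {s : ι → Γ(M, U)}
    (h : M.IsBasisOn U s) {V : X.Opens} (hV : V ≤ U) (i : ι) : h.basis hV i = M.mres hV (s i) := by
  classical
  rw [IsBasisOn.basis, Module.Basis.coe_ofEquivFun, LinearEquiv.symm_symm]
  exact (Fintype.linearCombination_apply_single _ _ _ _).trans (one_smul _ _)

/-- A criterion for a family of sections of the associated sheaf to be a basis. -/
lemma isBasisOn_toOf (P : _root_.PresheafOfModules.{u} (X.presheaf ⋙ forget₂ CommRingCat RingCat))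
    {U : X.Opens} (s : ι → P.sectionsModule (op U))
    (h : ∀ (V : X.Opens) (hV : V ≤ U), IsAffineOpen V →
      Function.Bijective fun c : ι → Γ(X, V) => ∑ i, c i • P.res (homOfLE hV).op (s i)) :
    (ofPresheaf P).IsBasisOn U fun i => toOf P U (s i) := by
  intro V hV
  have := toOf_comp_bijective P (piPresheaf_isSheaf X ι) U
    (fun V hV (c : ι → Γ(X, V)) => ∑ i, c i • P.res (homOfLE hV).op (s i)) ?_ h V hV
  · refine (congrArg Function.Bijective (funext fun c => ?_)).mp this
    rw [map_sum]
    refine Finset.sum_congr rfl fun i _ => ?_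
    rw [← toOf_res]
    exact (toOf P V).map_smul (c i) _
  · intro V W hW hV c
    have key : P.res (homOfLE hW).op (∑ i, c i • P.res (homOfLE hV).op (s i)) =
        ∑ i, P.res (homOfLE hW).op (c i • P.res (homOfLE hV).op (s i)) :=
      map_sum (P.map (homOfLE hW).op).hom _ _
    rw [key]
    refine Finset.sum_congr rfl fun i _ => ?_
    rw [PresheafOfModules.res_smul, ← PresheafOfModules.res_comp]
    rfl

lemma isBasisOn_of_isAffineOpen (M : X.Modules) {U : X.Opens} (s : ι → Γ(M, U))
    (h : ∀ (V : X.Opens) (hV : V ≤ U), IsAffineOpen V →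
      Function.Bijective fun c : ι → Γ(X, V) => ∑ i, c i • M.mres hV (s i)) :
    M.IsBasisOn U s := by
  refine bijective_of_isAffineOpen M (piPresheaf_isSheaf X ι) U
    (fun V hV (c : ι → Γ(X, V)) => ∑ i, c i • M.mres hV (s i)) ?_ h
  intro V W hW hV c
  rw [map_sum]
  refine Finset.sum_congr rfl fun i _ => ?_
  rw [mres_smul, mres_mres]
  rfl

end Basis

end AlgebraicGeometry.Scheme.Modules

/-! ### Bases and generators of tensor products, exterior powers and tensor powers. -/

namespace AlgebraicGeometry.Scheme.Modules
variable {X : Scheme.{u}}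
open scoped TensorProduct

/-- The section `s` of `M` over `U` freely generates `M` over every open contained in `U`. -/
def IsGeneratorOn (M : X.Modules) (U : X.Opens) (s : Γ(M, U)) : Prop :=
  M.IsBasisOn U fun _ : Unit => s

lemma isGeneratorOn_iff {M : X.Modules} {U : X.Opens} {s : Γ(M, U)} :
    M.IsGeneratorOn U s ↔ ∀ (V : X.Opens) (hV : V ≤ U),
      Function.Bijective fun c : Γ(X, V) => c • M.mres hV s := by
  refine forall₂_congr fun V hV => ?_
  rw [← (Equiv.funUnique Unit Γ(X, V)).symm.bijective.of_comp_iff]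
  simp [Function.comp_def]

/-- The section `m ⊗ n` of `M ⊗ N`. -/
def tmul {M N : X.Modules} {U : X.Opens} (m : Γ(M, U)) (n : Γ(N, U)) : Γ(tensor M N, U) :=
  toOf (PresheafOfModules.Monoidal.tensorObj (R := X.presheaf) M.val N.val) U
    ((m : M.val.obj (op U)) ⊗ₜ[(Γ(X, U) : Type u)] (n : N.val.obj (op U)))

lemma tmul_smul_left {M N : X.Modules} {U : X.Opens} (a : Γ(X, U)) (m : Γ(M, U)) (n : Γ(N, U)) :
    tmul (a • m) n = a • tmul m n := by
  refine Eq.trans ?_ ((toOf _ U).map_smul a _)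
  rfl

lemma tmul_smul_right {M N : X.Modules} {U : X.Opens} (a : Γ(X, U)) (m : Γ(M, U)) (n : Γ(N, U)) :
    tmul m (a • n) = a • tmul m n := by
  refine Eq.trans ?_ ((toOf _ U).map_smul a _)
  exact congrArg (toOf _ U) (TensorProduct.tmul_smul (R := Γ(X, U)) (M := Γ(M, U)) (N := Γ(N, U)) a m n)

lemma mres_tmul {M N : X.Modules} {V U : X.Opens} (h : V ≤ U) (m : Γ(M, U)) (n : Γ(N, U)) :
    (tensor M N).mres h (tmul m n) = tmul (M.mres h m) (N.mres h n) :=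
  (toOf_res _ h _).symm

/-- If `s` generates `M` over `U`, then tensoring with `s` identifies the sections of `N` and of
`M ⊗ N` over opens contained in `U`. -/
lemma IsGeneratorOn.tmul_bijective {M : X.Modules} {U : X.Opens} {s : Γ(M, U)}
    (h : M.IsGeneratorOn U s) (N : X.Modules) {V : X.Opens} (hV : V ≤ U) :
    Function.Bijective fun n : Γ(N, V) => tmul (M.mres hV s) n := by
  refine toOf_comp_bijective (PresheafOfModules.Monoidal.tensorObj (R := X.presheaf) M.val N.val)
    N.typePresheaf_isSheaf U
    (fun V hV (n : Γ(N, V)) => (M.mres hV s : Γ(M, V)) ⊗ₜ[(Γ(X, V) : Type u)] (n : Γ(N, V))) ?_ ?_ V hV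
  · intro V W hW hV n
    have : M.mres (hW.trans hV) s = M.mres hW (M.mres hV s) := (mres_mres _ _ _ _).symm
    simp only [this]
    rfl
  · intro V hV _
    -- Here `M(V)` is free on the restriction of `s`, so already the presheaf tensor product over
    -- `V` is `N(V)`.
    let e : Γ(X, V) ≃ₗ[Γ(X, V)] Γ(M, V) := LinearEquiv.ofBijective
      (LinearMap.toSpanSingleton Γ(X, V) Γ(M, V) (M.mres hV s)) (isGeneratorOn_iff.1 h V hV)
    have h1 : e 1 = M.mres hV s := one_smul _ _
    have h2 : ∀ n : Γ(N, V), ((TensorProduct.lid Γ(X, V) Γ(N, V)).symm ≪≫ₗ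
        TensorProduct.congr e (LinearEquiv.refl _ _)) n = M.mres hV s ⊗ₜ[Γ(X, V)] n := by
      intro n
      simp only [LinearEquiv.trans_apply, TensorProduct.lid_symm_apply,
        TensorProduct.congr_tmul, h1, LinearEquiv.refl_apply]
    exact (congrArg Function.Bijective (funext h2)).mp
      ((TensorProduct.lid Γ(X, V) Γ(N, V)).symm ≪≫ₗ
        TensorProduct.congr e (LinearEquiv.refl _ _)).bijective

lemma IsBasisOn.tmul {M N : X.Modules} {U : X.Opens} {s : Γ(M, U)}
    (h : M.IsGeneratorOn U s) {ι : Type} [Fintype ι] {t : ι → Γ(N, U)} (ht : N.IsBasisOn U t) :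
    (tensor M N).IsBasisOn U fun i => tmul s (t i) := by
  intro V hV
  refine (congrArg Function.Bijective (funext fun c => ?_)).mp
    ((h.tmul_bijective N hV).comp (ht V hV))
  simp only [Function.comp, mres_tmul]
  refine (map_sum (AddMonoidHom.mk' (fun n => Modules.tmul (M.mres hV s) n) fun a b => ?_) _ _).trans
    (Finset.sum_congr rfl fun i _ => tmul_smul_right _ _ _)
  refine Eq.trans ?_ ((toOf _ V).map_add _ _)
  exact congrArg (toOf _ V)
    (TensorProduct.tmul_add (R := Γ(X, V)) (M := Γ(M, V)) (N := Γ(N, V)) _ _ _)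

lemma IsGeneratorOn.tmul {M N : X.Modules} {U : X.Opens} {s : Γ(M, U)} {t : Γ(N, U)}
    (h : M.IsGeneratorOn U s) (ht : N.IsGeneratorOn U t) :
    (tensor M N).IsGeneratorOn U (tmul s t) :=
  IsBasisOn.tmul h ht

/-- The section `m₁ ∧ ⋯ ∧ mᵣ` of `⋀ʳ M`. -/
def wedge {M : X.Modules} {U : X.Opens} {r : ℕ} (m : Fin r → Γ(M, U)) :
    Γ(M.exteriorPower r, U) :=
  toOf (PresheafOfModules.exteriorPower (R := X.presheaf) M.val r) U
    (exteriorPower.ιMulti Γ(X, U) r (M := Γ(M, U)) m)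

lemma mres_wedge {M : X.Modules} {V U : X.Opens} (h : V ≤ U) {r : ℕ} (m : Fin r → Γ(M, U)) :
    (M.exteriorPower r).mres h (wedge m) = wedge fun i => M.mres h (m i) := by
  refine (toOf_res _ h _).symm.trans (congrArg (toOf _ V) ?_)
  exact PresheafOfModules.exteriorPowerMap_mk (R := X.presheaf) M.val r (homOfLE h).op m

end AlgebraicGeometry.Scheme.Modules

section

variable {R M N : Type*} [CommRing R] [AddCommGroup M] [Module R M] [AddCommGroup N] [Module R N]

/-- An alternating map is determined by its values on injective families of basis vectors. With as
many arguments as basis vectors these are permutations of the basis, where both sides pick up the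
same sign. -/
lemma Module.Basis.det_smul_apply_eq {ι : Type*} [Fintype ι] [DecidableEq ι]
    (e : Module.Basis ι R M) (f : M [⋀^ι]→ₗ[R] N) (v : ι → M) : f v = e.det v • f e := by
  suffices f = (LinearMap.toSpanSingleton R N (f e)).compAlternatingMap e.det by
    conv_lhs => rw [this]
    simp
  refine e.ext_alternating fun v hv => ?_
  obtain ⟨σ, rfl⟩ : ∃ σ : Equiv.Perm ι, ⇑σ = v :=
    ⟨Equiv.ofBijective v hv.bijective_of_finite, rfl⟩
  have h1 := f.map_perm e σ
  have h2 := e.det.map_perm e σ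
  simp only [Function.comp_def] at h1 h2
  simp [h1, h2, Module.Basis.det_self]

lemma AlternatingMap.map_matrix_smul_basis {ι : Type*} [Fintype ι] [DecidableEq ι]
    (e : Module.Basis ι R M) (f : M [⋀^ι]→ₗ[R] N) (A : Matrix ι ι R) :
    f (fun i => ∑ j, A i j • e j) = A.det • f e := by
  rw [e.det_smul_apply_eq, Module.Basis.det_apply, ← Matrix.det_transpose]
  congr 2
  ext i j
  simp [Module.Basis.toMatrix_apply, Finsupp.single_apply]

/-- The determinant form of the basis factors through the exterior power and supplies the inverse
map. -/
lemma exteriorPower.ιMulti_basis_bijective {r : ℕ} (e : Module.Basis (Fin r) R M) :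
    Function.Bijective fun c : R => c • exteriorPower.ιMulti R r e := by
  let g := exteriorPower.alternatingMapLinearEquiv e.det
  have hg : g (exteriorPower.ιMulti R r e) = 1 := by simp [g, Module.Basis.det_self]
  refine Function.bijective_iff_has_inverse.2 ⟨g, fun c => by simp [hg], fun x => ?_⟩
  suffices (LinearMap.toSpanSingleton R _ (exteriorPower.ιMulti R r e)).comp g = LinearMap.id from
    LinearMap.congr_fun this x
  refine exteriorPower.linearMap_ext (AlternatingMap.ext fun v => ?_)
  simp [g, (e.det_smul_apply_eq (exteriorPower.ιMulti R r) v), Module.Basis.det_self]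

end

namespace AlgebraicGeometry.Scheme.Modules
variable {X : Scheme.{u}}

lemma IsBasisOn.wedge {M : X.Modules} {U : X.Opens} {r : ℕ} {s : Fin r → Γ(M, U)}
    (h : M.IsBasisOn U s) : (M.exteriorPower r).IsGeneratorOn U (wedge s) := by
  refine isBasisOn_toOf _ _ fun V hV _ => ?_
  rw [← (Equiv.funUnique Unit Γ(X, V)).symm.bijective.of_comp_iff]
  refine (congrArg Function.Bijective (funext fun c => ?_)).mp
    (exteriorPower.ιMulti_basis_bijective (h.basis hV))
  have : ⇑(h.basis hV) = fun i => M.mres hV (s i) := funext fun i => h.basis_apply hV i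
  rw [this]
  refine Eq.trans ?_ (Finset.sum_singleton _ _).symm
  exact congrArg (c • ·) (PresheafOfModules.exteriorPowerMap_mk (R := X.presheaf) M.val r
    (homOfLE hV).op s).symm

/-- This turns a transition matrix of a module into the transition function of its top exterior
power; it serves both `Ω` and the principal parts. -/
lemma wedge_sum_smul {M : X.Modules} {U : X.Opens} {r : ℕ} {s : Fin r → Γ(M, U)}
    (h : M.IsBasisOn U s) (A : Matrix (Fin r) (Fin r) Γ(X, U)) :
    Modules.wedge (fun i => ∑ j, A i j • s j) = A.det • Modules.wedge s := by
  have hb : ⇑(h.basis le_rfl) = s := funext fun i => (h.basis_apply le_rfl i).trans (mres_self _ _)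
  refine Eq.trans (congrArg (toOf _ U) ?_) ((toOf _ U).map_smul _ _)
  rw [← hb]
  exact AlternatingMap.map_matrix_smul_basis (h.basis le_rfl) _ A

lemma structureSheaf_isGeneratorOn (U : X.Opens) :
    (structureSheaf X).IsGeneratorOn U (1 : Γ(X, U)) := by
  refine isGeneratorOn_iff.2 fun V hV => ?_
  refine (congrArg Function.Bijective (funext fun c => ?_)).mp Function.bijective_id
  refine (mul_one (c : Γ(X, V))).symm.trans (congrArg (c * ·) ?_)
  exact ((fres hV).map_one).symm

/-- The section `s ⊗ ⋯ ⊗ s` of a tensor power. -/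
def tpow {M : X.Modules} {U : X.Opens} (s : Γ(M, U)) : ∀ m : ℕ, Γ(M.tensorPower m, U)
  | 0 => (1 : Γ(X, U))
  | m + 1 => tmul (M := M.tensorPower m) (tpow s m) s

lemma mres_tpow {M : X.Modules} {V U : X.Opens} (h : V ≤ U) (s : Γ(M, U)) (m : ℕ) :
    (M.tensorPower m).mres h (tpow s m) = tpow (M.mres h s) m := by
  induction m with
  | zero => exact (fres h).map_one
  | succ m ih => exact (mres_tmul (M := M.tensorPower m) h _ _).trans (by rw [ih]; rfl)

lemma tpow_smul {M : X.Modules} {U : X.Opens} (a : Γ(X, U)) (s : Γ(M, U)) (m : ℕ) :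
    tpow (a • s) m = a ^ m • tpow s m := by
  induction m with
  | zero => rw [pow_zero, one_smul]; rfl
  | succ m ih =>
    change tmul (M := M.tensorPower m) (tpow (a • s) m) (a • s) = _
    rw [ih, tmul_smul_left, tmul_smul_right, smul_smul, pow_succ]
    rfl

lemma IsGeneratorOn.tpow {M : X.Modules} {U : X.Opens} {s : Γ(M, U)} (h : M.IsGeneratorOn U s)
    (m : ℕ) : (M.tensorPower m).IsGeneratorOn U (tpow s m) := by
  induction m with
  | zero => exact structureSheaf_isGeneratorOn U
  | succ m ih => exact ih.tmul h

end AlgebraicGeometry.Scheme.Modules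

/-! ### Gluing isomorphisms from transition functions; bases and local freeness. -/

namespace AlgebraicGeometry.Scheme.Modules
variable {X : Scheme.{u}}

lemma exists_mres_eq (M : X.Modules) {U : X.Opens} {κ : Type u} (V : κ → X.Opens)
    (hV : ∀ i, V i ≤ U) (cov : ∀ x ∈ U, ∃ i, x ∈ V i) (m : ∀ i, Γ(M, V i))
    (compat : ∀ i j, M.mres inf_le_left (m i) = M.mres (inf_le_right : V i ⊓ V j ≤ V j) (m j)) :
    ∃ n : Γ(M, U), ∀ i, M.mres (hV i) n = m i := by
  obtain ⟨n, hn, -⟩ := TopCat.Sheaf.existsUnique_gluing' ⟨M.presheaf, M.isSheaf⟩ V U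
    (fun i => homOfLE (hV i)) (fun x hx => Opens.mem_iSup.2 (cov x hx)) m compat
  exact ⟨n, hn⟩

/-- A morphism of modules from a compatible family of linear maps. -/
def homMk {M N : X.Modules} (φ : ∀ U : X.Opens, Γ(M, U) →ₗ[Γ(X, U)] Γ(N, U))
    (nat : ∀ (U V : X.Opens) (h : V ≤ U) (m : Γ(M, U)),
      φ V (M.mres h m) = N.mres h (φ U m)) : M ⟶ N :=
  SheafOfModules.Hom.mk
    { app := fun U => ModuleCat.ofHom (X := M.val.obj U) (Y := N.val.obj U) (φ U.unop)
      naturality := fun {U V} f => by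
        ext m
        exact nat U.unop V.unop (leOfHom f.unop) m }

lemma homMk_app {M N : X.Modules} (φ : ∀ U : X.Opens, Γ(M, U) →ₗ[Γ(X, U)] Γ(N, U))
    (nat : ∀ (U V : X.Opens) (h : V ≤ U) (m : Γ(M, U)),
      φ V (M.mres h m) = N.mres h (φ U m)) {U : X.Opens} (m : Γ(M, U)) :
    (homMk φ nat).app U m = φ U m := rfl

lemma isIso_of_bijective_app {M N : X.Modules} (φ : M ⟶ N)
    (h : ∀ U, Function.Bijective (φ.app U)) : IsIso φ :=
  Hom.isIso_iff_isIso_app.2 fun U => (ConcreteCategory.isIso_iff_bijective _).2 (h U)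

/-- Two modules which are freely generated by one element locally on `X`, with the same transition
functions, are isomorphic. -/
theorem nonempty_iso_of_isGeneratorOn {M N : X.Modules} {κ : Type u} (U : κ → X.Opens)
    (cov : ∀ x, ∃ i, x ∈ U i) (s : ∀ i, Γ(M, U i)) (t : ∀ i, Γ(N, U i))
    (hs : ∀ i, M.IsGeneratorOn (U i) (s i)) (ht : ∀ i, N.IsGeneratorOn (U i) (t i))
    (compat : ∀ i j, ∀ x ∈ U i, x ∈ U j → ∃ (W : X.Opens) (hi : W ≤ U i) (hj : W ≤ U j), x ∈ W ∧
      ∃ g : Γ(X, W), M.mres hi (s i) = g • M.mres hj (s j) ∧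
        N.mres hi (t i) = g • N.mres hj (t j)) : Nonempty (M ≅ N) := by
  -- The isomorphism is built through its graph: `m` and `n` correspond when, on every open inside
  -- some `U i`, the coefficient of `m` along `s i` is also that of `n` along `t i`.
  let R (V : X.Opens) (m : Γ(M, V)) (n : Γ(N, V)) : Prop :=
    ∀ (i : κ) (W : X.Opens) (hW : W ≤ V) (hi : W ≤ U i) (c : Γ(X, W)),
      M.mres hW m = c • M.mres hi (s i) → N.mres hW n = c • N.mres hi (t i)
  have hsI : ∀ (i : κ) (W : X.Opens) (hi : W ≤ U i) (c c' : Γ(X, W)),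
      c • M.mres hi (s i) = c' • M.mres hi (s i) → c = c' :=
    fun i W hi c c' h => (isGeneratorOn_iff.1 (hs i) W hi).1 h
  have hsS : ∀ (i : κ) (W : X.Opens) (hi : W ≤ U i) (m : Γ(M, W)), ∃ c, m = c • M.mres hi (s i) :=
    fun i W hi m => ((isGeneratorOn_iff.1 (hs i) W hi).2 m).imp fun _ h => h.symm
  have htI : ∀ (i : κ) (W : X.Opens) (hi : W ≤ U i) (c c' : Γ(X, W)),
      c • N.mres hi (t i) = c' • N.mres hi (t i) → c = c' :=
    fun i W hi c c' h => (isGeneratorOn_iff.1 (ht i) W hi).1 h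
  have htS : ∀ (i : κ) (W : X.Opens) (hi : W ≤ U i) (n : Γ(N, W)), ∃ c, n = c • N.mres hi (t i) :=
    fun i W hi m => ((isGeneratorOn_iff.1 (ht i) W hi).2 m).imp fun _ h => h.symm
  -- Coefficients along two different generators describe the same section of `M` exactly when they
  -- do so for `N`. This is where equality of the transition functions enters, and it makes the
  -- local pieces glue.
  have key : ∀ (i j : κ) (W : X.Opens) (hi : W ≤ U i) (hj : W ≤ U j) (c c' : Γ(X, W)),
      (c • M.mres hi (s i) = c' • M.mres hj (s j) ↔
        c • N.mres hi (t i) = c' • N.mres hj (t j)) := by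
    intro i j W hi hj c c'
    constructor
    · intro h
      refine eq_of_locally_mres_eq _ _ _ fun x hx => ?_
      obtain ⟨W', hi', hj', hxW, g, h1, h2⟩ := compat i j x (hi hx) (hj hx)
      refine ⟨W ⊓ W', inf_le_left, ⟨hx, hxW⟩, ?_⟩
      replace h1 := congrArg (M.mres (inf_le_right : W ⊓ W' ≤ W')) h1
      replace h2 := congrArg (N.mres (inf_le_right : W ⊓ W' ≤ W')) h2
      replace h := congrArg (M.mres (inf_le_left : W ⊓ W' ≤ W)) h
      simp only [mres_smul, mres_mres] at h1 h2 h ⊢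
      rw [h1, smul_smul] at h
      rw [h2, smul_smul, hsI _ _ _ _ _ h]
    · intro h
      refine eq_of_locally_mres_eq _ _ _ fun x hx => ?_
      obtain ⟨W', hi', hj', hxW, g, h1, h2⟩ := compat i j x (hi hx) (hj hx)
      refine ⟨W ⊓ W', inf_le_left, ⟨hx, hxW⟩, ?_⟩
      replace h1 := congrArg (M.mres (inf_le_right : W ⊓ W' ≤ W')) h1
      replace h2 := congrArg (N.mres (inf_le_right : W ⊓ W' ≤ W')) h2
      replace h := congrArg (N.mres (inf_le_left : W ⊓ W' ≤ W)) h
      simp only [mres_smul, mres_mres] at h1 h2 h ⊢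
      rw [h2, smul_smul] at h
      rw [h1, smul_smul, htI _ _ _ _ _ h]
  have ex : ∀ (V : X.Opens) (m : Γ(M, V)), ∃ n, R V m n := by
    intro V m
    choose c hc using fun i => hsS i (V ⊓ U i) inf_le_right (M.mres inf_le_left m)
    obtain ⟨n, hn⟩ := N.exists_mres_eq (fun i => V ⊓ U i) (fun i => inf_le_left)
      (fun x hx => (cov x).imp fun i hi => ⟨hx, hi⟩)
      (fun i => c i • N.mres inf_le_right (t i)) (fun i j => by
        simp only [mres_smul, mres_mres]
        rw [← key]
        have h1 := congrArg (M.mres (inf_le_left : V ⊓ U i ⊓ (V ⊓ U j) ≤ V ⊓ U i)) (hc i)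
        have h2 := congrArg (M.mres (inf_le_right : V ⊓ U i ⊓ (V ⊓ U j) ≤ V ⊓ U j)) (hc j)
        simp only [mres_smul, mres_mres] at h1 h2
        rw [← h1, ← h2])
    refine ⟨n, fun i W hW hi a ha => ?_⟩
    have h1 := congrArg (M.mres (le_inf hW hi)) (hc i)
    have h2 := congrArg (N.mres (le_inf hW hi)) (hn i)
    simp only [mres_smul, mres_mres] at h1 h2
    rw [h2, hsI _ _ _ _ _ (ha.symm.trans h1)]
  have uniq : ∀ (V : X.Opens) (m : Γ(M, V)) (n n' : Γ(N, V)), R V m n → R V m n' → n = n' := by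
    intro V m n n' h h'
    refine eq_of_locally_mres_eq _ _ _ fun x hx => ?_
    obtain ⟨i, hi⟩ := cov x
    obtain ⟨c, hc⟩ := hsS i (V ⊓ U i) inf_le_right (M.mres inf_le_left m)
    exact ⟨V ⊓ U i, inf_le_left, ⟨hx, hi⟩,
      (h i _ _ inf_le_right c hc).trans (h' i _ _ inf_le_right c hc).symm⟩
  have R_symm : ∀ (V : X.Opens) (m : Γ(M, V)) (n : Γ(N, V)), R V m n →
      ∀ (i : κ) (W : X.Opens) (hW : W ≤ V) (hi : W ≤ U i) (c : Γ(X, W)),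
      N.mres hW n = c • N.mres hi (t i) → M.mres hW m = c • M.mres hi (s i) := by
    intro V m n h i W hW hi c hc
    obtain ⟨c', hc'⟩ := hsS i W hi (M.mres hW m)
    rw [hc', htI _ _ _ _ _ (hc.symm.trans (h i W hW hi c' hc'))]
  choose F hF using ex
  let φ : M ⟶ N := homMk (fun V =>
      { toFun := F V
        map_add' := fun m m' => by
          refine uniq V _ _ _ (hF V _) fun i W hW hi c hc => ?_
          obtain ⟨a, ha⟩ := hsS i W hi (M.mres hW m)
          obtain ⟨a', ha'⟩ := hsS i W hi (M.mres hW m')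
          rw [map_add, hF V m i W hW hi a ha, hF V m' i W hW hi a' ha', ← add_smul]
          rw [map_add, ha, ha', ← add_smul] at hc
          rw [hsI _ _ _ _ _ hc]
        map_smul' := fun b m => by
          refine uniq V _ _ _ (hF V _) fun i W hW hi c hc => ?_
          obtain ⟨a, ha⟩ := hsS i W hi (M.mres hW m)
          rw [RingHom.id_apply, mres_smul, hF V m i W hW hi a ha, smul_smul]
          rw [mres_smul, ha, smul_smul] at hc
          rw [hsI _ _ _ _ _ hc] }) (fun V V' h m => by
      refine uniq V' _ _ _ (hF V' _) fun i W hW hi c hc => ?_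
      rw [mres_mres] at hc
      exact (mres_mres _ _ _ _).trans (hF V m i W (hW.trans h) hi c hc))
  have : IsIso φ := isIso_of_bijective_app φ fun V => by
    change Function.Bijective (F V)
    constructor
    · intro m m' h
      refine eq_of_locally_mres_eq _ _ _ fun x hx => ?_
      obtain ⟨i, hi⟩ := cov x
      obtain ⟨c, hc⟩ := htS i (V ⊓ U i) inf_le_right (N.mres inf_le_left (F V m))
      exact ⟨V ⊓ U i, inf_le_left, ⟨hx, hi⟩, (R_symm V m _ (hF V m) i _ _ inf_le_right c hc).trans
        (R_symm V m' _ (hF V m') i _ _ inf_le_right c (h ▸ hc)).symm⟩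
    · intro n
      choose c hc using fun i => htS i (V ⊓ U i) inf_le_right (N.mres inf_le_left n)
      obtain ⟨m, hm⟩ := M.exists_mres_eq (fun i => V ⊓ U i) (fun i => inf_le_left)
        (fun x hx => (cov x).imp fun i hi => ⟨hx, hi⟩)
        (fun i => c i • M.mres inf_le_right (s i)) (fun i j => by
          simp only [mres_smul, mres_mres]
          rw [key]
          have h1 := congrArg (N.mres (inf_le_left : V ⊓ U i ⊓ (V ⊓ U j) ≤ V ⊓ U i)) (hc i)
          have h2 := congrArg (N.mres (inf_le_right : V ⊓ U i ⊓ (V ⊓ U j) ≤ V ⊓ U j)) (hc j)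
          simp only [mres_smul, mres_mres] at h1 h2
          rw [← h1, ← h2])
      refine ⟨m, uniq V m _ _ (hF V m) fun i W hW hi a ha => ?_⟩
      have h1 := congrArg (N.mres (le_inf hW hi)) (hc i)
      have h2 := congrArg (M.mres (le_inf hW hi)) (hm i)
      simp only [mres_smul, mres_mres] at h1 h2
      rw [h1, hsI _ _ _ _ _ (h2.symm.trans ha)]
  exact ⟨asIso φ⟩

section Desc

variable {ι : Type} [Fintype ι]

/-- The morphism from a module with a basis of global sections to `N` with prescribed values on the
basis. -/
lemma IsBasisOn.exists_hom {M N : X.Modules} {s : ι → Γ(M, ⊤)} (h : M.IsBasisOn ⊤ s)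
    (t : ι → Γ(N, ⊤)) : ∃ φ : M ⟶ N, ∀ i, φ.app ⊤ (s i) = t i := by
  refine ⟨homMk (fun V => (h.basis le_top).constr Γ(X, V) fun i => N.mres le_top (t i)) ?_, ?_⟩
  · intro U V hVU m
    obtain ⟨c, rfl⟩ := (h U le_top).2 m
    have hb : ∀ (W : X.Opens) i, M.mres le_top (s i) = h.basis (le_top : W ≤ ⊤) i :=
      fun W i => (h.basis_apply le_top i).symm
    simp only [map_sum, mres_smul, mres_mres]
    simp only [hb, _root_.map_smul, Module.Basis.constr_basis, mres_smul, mres_mres]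
  · intro i
    rw [homMk_app]
    have : s i = h.basis le_top i := ((h.basis_apply le_top i).trans (mres_self _ _)).symm
    rw [this, Module.Basis.constr_basis, mres_self]

lemma IsBasisOn.hom_ext {M N : X.Modules} {s : ι → Γ(M, ⊤)} (h : M.IsBasisOn ⊤ s)
    {φ ψ : M ⟶ N} (hφ : ∀ i, φ.app ⊤ (s i) = ψ.app ⊤ (s i)) : φ = ψ := by
  refine Modules.hom_ext _ _ fun U => ?_
  ext m
  obtain ⟨c, rfl⟩ := (h U le_top).2 m
  simp only [map_sum, Hom.app_smul, app_mres, hφ]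

end Desc


/-- A global section, as a compatible family of sections. -/
def toSections {M : X.Modules} (s : Γ(M, ⊤)) : SheafOfModules.sections M :=
  PresheafOfModules.sectionsMk (M := M.val) (fun V => M.mres (le_top : V.unop ≤ ⊤) s)
    fun _ _ f => M.mres_mres le_top (leOfHom f.unop) s

lemma toSections_eval {M : X.Modules} (s : SheafOfModules.sections M) :
    toSections (s.1 (op ⊤)) = s :=
  PresheafOfModules.sections_ext _ _ fun V =>
    PresheafOfModules.sections_property s (homOfLE (le_top : V.unop ≤ ⊤)).op

lemma IsBasisOn.nonempty_iso_freeOfRank {M : X.Modules} {r : ℕ} {s : Fin r → Γ(M, ⊤)}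
    (h : M.IsBasisOn ⊤ s) : Nonempty (M ≅ freeOfRank X r) := by
  obtain ⟨φ, hφ⟩ := h.exists_hom (N := freeOfRank X r)
    fun i => (SheafOfModules.freeSection (R := X.ringCatSheaf) (ULift.up i)).1 (op ⊤)
  let ψ : freeOfRank X r ⟶ M := (SheafOfModules.freeHomEquiv (R := X.ringCatSheaf) M).symm
    fun i => toSections (s i.down)
  have hψ : ∀ i, ψ.app ⊤ ((SheafOfModules.freeSection (R := X.ringCatSheaf) (ULift.up i)).1
      (op ⊤)) = s i := fun i => by
    have := congrFun ((SheafOfModules.freeHomEquiv (R := X.ringCatSheaf) M).apply_symm_apply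
      fun i => toSections (s i.down)) (ULift.up i)
    exact (congrArg (fun t : SheafOfModules.sections M => t.1 (op ⊤)) this).trans (mres_self _ _)
  refine ⟨⟨φ, ψ, h.hom_ext fun i => ?_, ?_⟩⟩
  · rw [Hom.comp_app]
    exact (congrArg (ψ.app ⊤) (hφ i)).trans (hψ i)
  · apply (SheafOfModules.freeHomEquiv (R := X.ringCatSheaf) (freeOfRank X r)).injective
    funext i
    refine (toSections_eval (M := freeOfRank X r) _).symm.trans
      ((congrArg (toSections (M := freeOfRank X r)) ?_).trans
        (toSections_eval (M := freeOfRank X r) _))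
    exact (congrArg (φ.app ⊤) (hψ i.down)).trans (hφ i.down)

lemma IsBasisOn.of_iso {M N : X.Modules} (e : M ≅ N) {U : X.Opens} {ι : Type} [Fintype ι]
    {s : ι → Γ(M, U)} (h : M.IsBasisOn U s) : N.IsBasisOn U fun i => e.hom.app U (s i) := by
  intro V hV
  have : Function.Bijective (e.hom.app V) := (ConcreteCategory.isIso_iff_bijective _).1 inferInstance
  refine (congrArg Function.Bijective (funext fun c => ?_)).mp (this.comp (h V hV))
  simp only [Function.comp, map_sum, Hom.app_smul, app_mres]

/-- Sections of the restriction of `M` to an open subset. -/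
def restrictEquiv (M : X.Modules) (U : X.Opens) (W : U.toScheme.Opens) :
    Γ(M.restrict U.ι, W) ≃+ Γ(M, U.ι ''ᵁ W) :=
  (M.restrictAppIso U.ι W).addCommGroupIsoToAddEquiv

lemma restrictEquiv_smul (M : X.Modules) (U : X.Opens) {W : U.toScheme.Opens}
    (a : Γ(U.toScheme, W)) (m : Γ(M.restrict U.ι, W)) :
    M.restrictEquiv U W (a • m) = (show Γ(X, U.ι ''ᵁ W) from a) • M.restrictEquiv U W m := by
  have h : (U.ι.appIso W).inv a = a := by
    rw [Scheme.Opens.ι_appIso]; rfl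
  have h2 : M.restrictEquiv U W (a • m) = ((U.ι.appIso W).inv a) • M.restrictEquiv U W m := rfl
  rw [h2, h]

lemma restrictEquiv_mres (M : X.Modules) (U : X.Opens) {W W' : U.toScheme.Opens} (h : W' ≤ W)
    (m : Γ(M.restrict U.ι, W)) : M.restrictEquiv U W' ((M.restrict U.ι).mres h m) =
      M.mres (Scheme.Hom.image_mono _ h) (M.restrictEquiv U W m) := rfl

lemma bijective_restrict_iff {M : X.Modules} {U : X.Opens} {ι : Type} [Fintype ι]
    (t : ι → Γ(M.restrict U.ι, ⊤)) (W : U.toScheme.Opens) :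
    (Function.Bijective fun c : ι → Γ(U.toScheme, W) =>
        ∑ i, c i • (M.restrict U.ι).mres (le_top : W ≤ ⊤) (t i)) ↔
      Function.Bijective fun c : ι → Γ(X, U.ι ''ᵁ W) =>
        ∑ i, c i • (M.mres (Scheme.Hom.image_mono U.ι (le_top : W ≤ ⊤)) (M.restrictEquiv U ⊤ (t i)) :
          Γ(M, U.ι ''ᵁ W)) := by
  rw [← Function.Bijective.of_comp_iff' (M.restrictEquiv U W).bijective]
  refine Iff.of_eq (congrArg (Function.Bijective (α := ι → Γ(X, U.ι ''ᵁ W))) (funext fun c => ?_))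
  refine (map_sum (M.restrictEquiv U W) _ _).trans (Finset.sum_congr rfl fun i _ => ?_)
  refine (restrictEquiv_smul M U _ _).trans ?_
  rw [restrictEquiv_mres]

lemma isBasisOn_restrict_iff {M : X.Modules} {U : X.Opens} {ι : Type} [Fintype ι]
    (t : ι → Γ(M.restrict U.ι, ⊤)) : (M.restrict U.ι).IsBasisOn ⊤ t ↔
      M.IsBasisOn U (fun i => M.mres U.ι_image_top.ge (M.restrictEquiv U ⊤ (t i))) := by
  constructor
  · intro h V hV
    obtain ⟨W, rfl⟩ : ∃ W : U.toScheme.Opens, V = U.ι ''ᵁ W :=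
      ⟨U.ι ⁻¹ᵁ V, ((Scheme.Hom.image_preimage_eq_opensRange_inf _ _).trans (by simpa)).symm⟩
    simp only [mres_mres]
    exact (bijective_restrict_iff t W).1 (h W le_top)
  · intro h W hW
    refine (bijective_restrict_iff t W).2 ?_
    have := h _ (U.ι_image_le W)
    simp only [mres_mres] at this
    exact this

lemma isLocallyFreeOfRank_of_isBasisOn {M : X.Modules} {r : ℕ}
    (h : ∀ x : X, ∃ (U : X.Opens) (_ : x ∈ U) (s : Fin r → Γ(M, U)), M.IsBasisOn U s) :
    M.IsLocallyFreeOfRank r := by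
  intro x
  obtain ⟨U, hx, s, hs⟩ := h x
  refine ⟨U, hx, IsBasisOn.nonempty_iso_freeOfRank (s := fun i => (M.restrictEquiv U ⊤).symm
    (M.mres U.ι_image_top.le (s i))) ((isBasisOn_restrict_iff _).2 ?_)⟩
  simpa [mres_mres, mres_self] using hs

lemma IsLineBundle.exists_isGeneratorOn {L : X.Modules} (hL : L.IsLineBundle) (x : X) :
    ∃ (U : X.Opens) (_ : x ∈ U) (s : Γ(L, U)), L.IsGeneratorOn U s := by
  obtain ⟨U, hx, ⟨e⟩⟩ := hL x
  have h1 : (structureSheaf U.toScheme).IsBasisOn ⊤ fun _ : Fin 1 => (1 : Γ(U.toScheme, ⊤)) := by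
    intro V hV
    rw [← (Equiv.funUnique (Fin 1) Γ(U.toScheme, V)).symm.bijective.of_comp_iff]
    simpa [Function.comp_def] using
      isGeneratorOn_iff.1 (structureSheaf_isGeneratorOn (X := U.toScheme) ⊤) V hV
  obtain ⟨e'⟩ := h1.nonempty_iso_freeOfRank
  have h2 := (isBasisOn_restrict_iff _).1 (h1.of_iso (e' ≪≫ e.symm))
  refine ⟨U, hx, L.mres U.ι_image_top.ge (L.restrictEquiv U ⊤ ((e' ≪≫ e.symm).hom.app ⊤
    (1 : Γ(U.toScheme, ⊤)))), fun V hV => ?_⟩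
  have h3 := h2 V hV
  rw [← (Equiv.funUnique (Fin 1) Γ(X, V)).symm.bijective.of_comp_iff] at h3
  rw [← (Equiv.funUnique Unit Γ(X, V)).symm.bijective.of_comp_iff]
  simpa [Function.comp_def] using h3

end AlgebraicGeometry.Scheme.Modules

/-! ### Pullbacks of local generators. -/

namespace AlgebraicGeometry.Scheme.Modules
variable {X : Scheme.{u}}

lemma mres_bijective_of_eq (M : X.Modules) {U V : X.Opens} (h : V = U) :
    Function.Bijective (M.mres h.le) := by
  subst h
  exact (congrArg Function.Bijective (funext fun m => (M.mres_self m).symm)).mp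
    Function.bijective_id

/-- A module whose morphisms are determined by the value at a global section `t`, and which has
a morphism to the structure sheaf mapping `t` to `1`, is generated by `t`. -/
lemma isGeneratorOn_top_of_hom {M : X.Modules} (t : Γ(M, ⊤)) (φ : M ⟶ structureSheaf X)
    (hφ : φ.app ⊤ t = (1 : Γ(X, ⊤)))
    (inj : ∀ ψ : M ⟶ M, ψ.app ⊤ t = t → ψ = 𝟙 M) : M.IsGeneratorOn ⊤ t := by
  have h1 : (structureSheaf X).IsBasisOn ⊤ fun _ : Unit => (1 : Γ(X, ⊤)) :=
    structureSheaf_isGeneratorOn ⊤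
  obtain ⟨ψ, hψ⟩ := h1.exists_hom (N := M) fun _ => t
  have := h1.of_iso ⟨ψ, φ, h1.hom_ext fun _ => by
      refine (congrArg (φ.app ⊤) (hψ ())).trans hφ, inj _ ?_⟩
  · exact (congrArg (M.IsBasisOn ⊤) (funext hψ)).mp this
  · exact (congrArg (ψ.app ⊤) hφ).trans (hψ ())

/-- If `K` is a module whose sections over `V` are its sections over `V ∩ U`, then morphisms to `K`
from a module freely generated by `e` on `U` are determined by the image of `e`. -/
lemma IsGeneratorOn.hom_ext_of_bijective {L K : X.Modules} {U : X.Opens} {e : Γ(L, U)}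
    (he : L.IsGeneratorOn U e)
    (hK : ∀ V : X.Opens, Function.Injective (K.mres (inf_le_left : V ⊓ U ≤ V)))
    {φ ψ : L ⟶ K} (h : φ.app U e = ψ.app U e) : φ = ψ := by
  refine Modules.hom_ext _ _ fun V => ?_
  ext m
  apply hK V
  obtain ⟨c, hc⟩ := (isGeneratorOn_iff.1 he _ (inf_le_right : V ⊓ U ≤ U)).2 (L.mres inf_le_left m)
  rw [← app_mres, ← app_mres, ← hc]
  simp only [Hom.app_smul, app_mres, h]

/-- Although `L` is only known to be free on `U`, a section over `V` can be restricted to `V ⊓ U`,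
mapped there by its coefficient along `e`, and the result extended uniquely to `V` by the assumption
on `K`. -/
lemma IsGeneratorOn.exists_hom_of_bijective {L K : X.Modules} {U : X.Opens} {e : Γ(L, U)}
    (he : L.IsGeneratorOn U e)
    (hK : ∀ V : X.Opens, Function.Bijective (K.mres (inf_le_left : V ⊓ U ≤ V)))
    (κ : Γ(K, U)) : ∃ φ : L ⟶ K, φ.app U e = κ := by
  have ex : ∀ (V : X.Opens) (m : Γ(L, V)), ∃ n : Γ(K, V), ∀ c : Γ(X, V ⊓ U),
      c • L.mres inf_le_right e = L.mres inf_le_left m →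
        K.mres inf_le_left n = c • K.mres inf_le_right κ := by
    intro V m
    obtain ⟨c, hc⟩ :=
      (isGeneratorOn_iff.1 he _ (inf_le_right : V ⊓ U ≤ U)).2 (L.mres inf_le_left m)
    obtain ⟨n, hn⟩ := (hK V).2 (c • K.mres inf_le_right κ)
    refine ⟨n, fun c' hc' => ?_⟩
    rw [hn, (isGeneratorOn_iff.1 he _ inf_le_right).1 (hc.trans hc'.symm)]
  have ex' : ∀ (V : X.Opens) (m : Γ(L, V)), ∃ c : Γ(X, V ⊓ U),
      c • L.mres inf_le_right e = L.mres inf_le_left m := fun V m =>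
    (isGeneratorOn_iff.1 he _ (inf_le_right : V ⊓ U ≤ U)).2 (L.mres inf_le_left m)
  choose F hF using ex
  refine ⟨homMk (fun V =>
      { toFun := F V
        map_add' := fun m m' => (hK V).1 ?_
        map_smul' := fun b m => (hK V).1 ?_ }) (fun V V' h m => (hK V').1 ?_), (hK U).1 ?_⟩
  · obtain ⟨a, ha⟩ := ex' V m
    obtain ⟨a', ha'⟩ := ex' V m'
    rw [map_add, hF V m a ha, hF V m' a' ha', hF V (m + m') (a + a'), add_smul]
    rw [add_smul, ha, ha', map_add]
  · obtain ⟨a, ha⟩ := ex' V m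
    rw [RingHom.id_apply, mres_smul, hF V m a ha, hF V (b • m) (fres inf_le_left b * a), mul_smul]
    rw [mul_smul, ha, mres_smul]
  · obtain ⟨a, ha⟩ := ex' V m
    have h2 := congrArg (K.mres (inf_le_inf_right U h)) (hF V m a ha)
    have h3 := hF V' (L.mres h m) (fres (inf_le_inf_right U h) a) (by
      have := congrArg (L.mres (inf_le_inf_right U h)) ha
      simpa only [mres_smul, mres_mres] using this)
    simp only [mres_smul, mres_mres] at h2 h3 ⊢
    exact h3.trans h2.symm
  · rw [homMk_app]
    refine (hF U e 1 (one_smul _ _)).trans (one_smul _ _)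

variable {Z : Scheme.{u}} (q : Z ⟶ X)

/-- The pullback of a section of `L`. -/
def pullbackSection (L : X.Modules) {U : X.Opens} (e : Γ(L, U)) :
    Γ((pullback q).obj L, q ⁻¹ᵁ U) :=
  ((pullbackPushforwardAdjunction q).unit.app L).app U e

lemma pullbackSection_smul (L : X.Modules) {U : X.Opens} (a : Γ(X, U)) (e : Γ(L, U)) :
    pullbackSection q L (a • e) = q.app U a • pullbackSection q L e :=
  Hom.app_smul ((pullbackPushforwardAdjunction q).unit.app L) a e

lemma mres_pullbackSection (L : X.Modules) {U V : X.Opens} (h : V ≤ U) (e : Γ(L, U)) :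
    ((pullback q).obj L).mres (q.preimage_mono h) (pullbackSection q L e) =
      pullbackSection q L (L.mres h e) :=
  (app_mres ((pullbackPushforwardAdjunction q).unit.app L) h e).symm

/-- The pullback is accessible only through its adjunction, so this is a Yoneda argument. Morphisms
from the restriction of `q^*L` to `W` into `N` are morphisms from `L` to the direct image of `N` on
`X`, and these correspond to global sections of `N` by evaluation at `e`. The structure sheaf of `W`
has the same universal property. -/
theorem IsGeneratorOn.pullbackSection {L : X.Modules} {U : X.Opens} {e : Γ(L, U)}
    (he : L.IsGeneratorOn U e) :
    ((pullback q).obj L).IsGeneratorOn (q ⁻¹ᵁ U) (Modules.pullbackSection q L e) := by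
  set P := (pullback q).obj L
  set W := q ⁻¹ᵁ U
  set η := Modules.pullbackSection q L e
  let t : Γ(P.restrict W.ι, ⊤) := (P.restrictEquiv W ⊤).symm (P.mres W.ι_image_top.le η)
  -- Since `W` lies over `U`, sections of this direct image over `V` and over `V ⊓ U` agree; this
  -- allows the extension lemmas above to be applied.
  let K (N : W.toScheme.Modules) : X.Modules := (pushforward q).obj ((pushforward W.ι).obj N)
  have hpre : ∀ V : X.Opens, W.ι ⁻¹ᵁ q ⁻¹ᵁ (V ⊓ U) = W.ι ⁻¹ᵁ q ⁻¹ᵁ V := by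
    intro V
    ext x
    exact ⟨fun h => h.1, fun h => ⟨h, x.2⟩⟩
  have htop : W.ι ⁻¹ᵁ W = ⊤ := W.ι_preimage_self
  have hK : ∀ (N : W.toScheme.Modules) (V : X.Opens),
      Function.Bijective ((K N).mres (inf_le_left : V ⊓ U ≤ V)) :=
    fun N V => mres_bijective_of_eq N (hpre V)
  let E (N : W.toScheme.Modules) : (P.restrict W.ι ⟶ N) ≃ (L ⟶ K N) :=
    ((restrictAdjunction W.ι).homEquiv P N).trans
      ((pullbackPushforwardAdjunction q).homEquiv L ((pushforward W.ι).obj N))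
  have hE : ∀ N (φ : P.restrict W.ι ⟶ N), (E N φ).app U e = N.mres htop.le (φ.app ⊤ t) := by
    intro N φ
    have h1 : (E N φ).app U e =
      φ.app (W.ι ⁻¹ᵁ W) (((restrictAdjunction W.ι).unit.app P).app W η) := by
      simp only [E, Equiv.trans_apply, Adjunction.homEquiv_unit]
      rfl
    rw [h1, ← app_mres]
    refine congrArg (φ.app (W.ι ⁻¹ᵁ W)) ?_
    apply (P.restrictEquiv W _).injective
    rw [restrictEquiv_mres]
    simp only [t, AddEquiv.apply_symm_apply, mres_mres]
    rfl
  suffices h : (P.restrict W.ι).IsGeneratorOn ⊤ t by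
    have := (isBasisOn_restrict_iff _).1 h
    simp only [t, AddEquiv.apply_symm_apply, mres_mres, mres_self] at this
    exact this
  -- Under the adjunctions this becomes the map to the structure sheaf sending the pulled back
  -- generator to `1`.
  obtain ⟨φ, hφ⟩ := he.exists_hom_of_bijective (hK (structureSheaf _))
    ((structureSheaf W.toScheme).mres htop.le (1 : Γ(W.toScheme, ⊤)))
  refine isGeneratorOn_top_of_hom t ((E _).symm φ) ?_ fun ψ hψ => ?_
  · apply (mres_bijective_of_eq _ htop).1
    rw [← hE, Equiv.apply_symm_apply, hφ]
  · apply (E _).injective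
    apply he.hom_ext_of_bijective (fun V => (hK _ V).1)
    rw [hE, hE, hψ]
    rfl

end AlgebraicGeometry.Scheme.Modules

/-! ### The determinant of a linear substitution on polynomials of degree at most `l`. -/

namespace MvPolynomial

/-- Exponents of monomials of degree at most `l`. -/
abbrev BoundedExponent (ι : Type*) (l : ℕ) := {α : ι →₀ ℕ // α.degree ≤ l}

namespace BoundedExponent

variable (ι : Type*) [Fintype ι] (l : ℕ)

instance : Fintype (BoundedExponent ι l) := (Finsupp.finite_of_degree_le (σ := ι) l).fintype

/-- Homogenization of exponents. -/
def homogenize : BoundedExponent ι l ≃ {P : Option ι → ℕ // ∑ i, P i = l} where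
  toFun α := ⟨fun o => o.elim (l - α.1.degree) α.1, by
    have := α.2
    simp only [Fintype.sum_option, Option.elim, ← Finsupp.degree_eq_sum]
    omega⟩
  invFun P := ⟨Finsupp.equivFunOnFinite.symm fun i => P.1 (some i), by
    have := P.2
    simp only [Fintype.sum_option] at this
    simp only [Finsupp.degree_eq_sum, Finsupp.equivFunOnFinite_symm_apply_apply]
    omega⟩
  left_inv α := by ext; simp
  right_inv P := by
    have := P.2
    simp only [Fintype.sum_option] at this
    ext (_ | i)
    · simp only [Finsupp.degree_eq_sum, Option.elim, Finsupp.equivFunOnFinite_symm_apply_apply]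
      omega
    · simp

/-- Stars and bars, with a slack variable making the total degree exactly `l`. -/
lemma card : Fintype.card (BoundedExponent ι l) =
    (Fintype.card ι + l).choose (Fintype.card ι) := by
  classical
  rw [Fintype.card_congr ((homogenize ι l).trans (Sym.equivNatSumOfFintype (Option ι) l).symm),
    Sym.card_sym_eq_choose, Fintype.card_option,
    show Fintype.card ι + 1 + l - 1 = Fintype.card ι + l by omega, Nat.choose_symm_add]

variable {ι}

/-- Only exponents with `α i ≥ 1` contribute, and these are `β + single i 1` with `β` of degree at
most one less. The sum thus grows by the number of such `β` at each step of the induction, which is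
Pascal's rule. -/
lemma sum_apply (i : ι) : ∑ α : BoundedExponent ι l, α.1 i =
    (Fintype.card ι + l).choose (Fintype.card ι + 1) := by
  classical
  induction l with
  | zero =>
    rw [Finset.sum_eq_zero]
    · simp
    · intro α _
      have := (Finsupp.le_degree i α.1).trans α.2
      omega
  | succ l ih =>
    let s : BoundedExponent ι l → BoundedExponent ι (l + 1) := fun β =>
      ⟨β.1 + Finsupp.single i 1, by simpa using β.2⟩
    have hs : Function.Injective s := fun β β' h => by
      have := congrArg Subtype.val h
      exact Subtype.ext (add_right_cancel this)
    rw [← Finset.sum_subset (Finset.subset_univ (Finset.univ.image s)),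
      Finset.sum_image hs.injOn]
    · simp only [s, Finsupp.add_apply, Finsupp.single_eq_same, Finset.sum_add_distrib, ih,
        Finset.sum_const, Finset.card_univ, smul_eq_mul, mul_one, card]
      rw [← add_assoc, Nat.choose_succ_succ', add_comm]
    · intro α _ hα
      by_contra h
      refine hα (Finset.mem_image.2 ⟨⟨α.1 - Finsupp.single i 1, ?_⟩, Finset.mem_univ _, ?_⟩)
      · have h1 : α.1 = α.1 - Finsupp.single i 1 + Finsupp.single i 1 :=
          (tsub_add_cancel_of_le (by simpa [Nat.one_le_iff_ne_zero] using h)).symm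
        have h2 := congrArg Finsupp.degree h1
        have := α.2
        simp only [map_add, Finsupp.degree_single] at h2
        omega
      · exact Subtype.ext (tsub_add_cancel_of_le (by simpa [Nat.one_le_iff_ne_zero] using h))

end BoundedExponent

variable {ι : Type*} [Fintype ι] {A : Type*} [CommRing A]

/-- The product `∏ i, (∑ j, J i j * X j) ^ α i`. -/
def linProd (J : Matrix ι ι A) (α : ι →₀ ℕ) : MvPolynomial ι A :=
  ∏ i, (∑ j, C (J i j) * X j) ^ α i

lemma isHomogeneous_linProd (J : Matrix ι ι A) (α : ι →₀ ℕ) :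
    (linProd J α).IsHomogeneous α.degree := by
  rw [Finsupp.degree_eq_sum]
  refine IsHomogeneous.prod _ _ _ fun i _ => ?_
  have : (∑ j, C (J i j) * X j : MvPolynomial ι A).IsHomogeneous 1 :=
    IsHomogeneous.sum _ _ _ fun j _ => isHomogeneous_C_mul_X _ _
  simpa using this.pow (α i)

variable (l : ℕ)

/-- The matrix of the linear substitution `X i ↦ ∑ j, J i j * X j` on polynomials of degree at
most `l`, in the basis of monomials. -/
def substMatrix (J : Matrix ι ι A) :
    Matrix (BoundedExponent ι l) (BoundedExponent ι l) A :=
  Matrix.of fun α β => coeff β.1 (linProd J α.1)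

lemma eq_sum_of_degree_le {P : MvPolynomial ι A} (h : P.totalDegree ≤ l) :
    P = ∑ β : BoundedExponent ι l, monomial β.1 (coeff β.1 P) := by
  classical
  ext γ
  simp only [coeff_sum, coeff_monomial]
  by_cases hγ : γ.degree ≤ l
  · rw [Finset.sum_eq_single ⟨γ, hγ⟩ (fun β _ hβ => if_neg fun h => hβ (Subtype.ext h)) (by simp)]
    simp
  · rw [Finset.sum_eq_zero fun β _ => if_neg fun h : β.1 = γ => hγ (h ▸ β.2)]
    by_contra hc
    exact hγ (le_trans ((Finsupp.degree_eq_sum γ).trans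
      (Finsupp.sum_fintype γ (fun _ e => e) fun _ => rfl).symm).le
      ((le_totalDegree (mem_support_iff.2 hc)).trans h))

/-- Linear substitutions compose, and they preserve degree, so passing to matrices on bounded degree
loses no terms. -/
lemma substMatrix_mul (J K : Matrix ι ι A) :
    substMatrix l (J * K) = substMatrix l J * substMatrix l K := by
  ext α γ
  let σ : MvPolynomial ι A →ₐ[A] MvPolynomial ι A := aeval fun i => ∑ j, C (K i j) * X j
  have h1 : linProd (J * K) α.1 = σ (linProd J α.1) := by
    simp only [linProd, map_prod, map_pow, map_sum, map_mul]
    refine Finset.prod_congr rfl fun i _ => congrArg (· ^ _) ?_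
    have : ∀ a : A, σ (C a) = C a := fun a => σ.commutes a
    simp only [this, σ, aeval_X, Matrix.mul_apply, map_sum, Finset.sum_mul, Finset.mul_sum, map_mul]
    rw [Finset.sum_comm]
    simp only [mul_assoc]
  have h2 := eq_sum_of_degree_le l ((isHomogeneous_linProd J α.1).totalDegree_le.trans α.2)
  have h3 : ∀ (β : ι →₀ ℕ) (a : A), σ (monomial β a) = C a * linProd K β := by
    intro β a
    simp only [σ, aeval_monomial, linProd]
    rw [Finsupp.prod_fintype _ _ (by simp)]
    rfl
  simp only [substMatrix, Matrix.of_apply, Matrix.mul_apply]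
  rw [h1, h2, map_sum, coeff_sum]
  simp only [h3, coeff_C_mul]
  rw [← h2]

lemma substMatrix_map {B : Type*} [CommRing B] (f : A →+* B) (J : Matrix ι ι A) :
    substMatrix l (J.map f) = (substMatrix l J).map f := by
  ext α β
  simp only [substMatrix, Matrix.of_apply, Matrix.map_apply, ← coeff_map]
  simp [linProd, map_prod]

/-- Monomials are eigenvectors, and the total exponent of each `d i` is the same number by
`BoundedExponent.sum_apply`. -/
lemma det_substMatrix_diagonal [DecidableEq ι] (d : ι → A) :
    (substMatrix l (Matrix.diagonal d)).det =
      (Matrix.diagonal d).det ^ (Fintype.card ι + l).choose (Fintype.card ι + 1) := by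
  classical
  have h : substMatrix l (Matrix.diagonal d) =
      Matrix.diagonal fun α : BoundedExponent ι l => ∏ i, d i ^ α.1 i := by
    ext α β
    have : linProd (Matrix.diagonal d) α.1 = monomial α.1 (∏ i, d i ^ α.1 i) := by
      rw [monomial_eq, Finsupp.prod_fintype _ _ (by simp), map_prod, ← Finset.prod_mul_distrib]
      refine Finset.prod_congr rfl fun i _ => ?_
      rw [Finset.sum_eq_single i (fun j _ hj => by simp [Matrix.diagonal_apply_ne' _ hj])
        (by simp), Matrix.diagonal_apply_eq, mul_pow, map_pow]
    simp [substMatrix, this, coeff_monomial, Matrix.diagonal_apply, Subtype.ext_iff]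
  rw [h, Matrix.det_diagonal, Matrix.det_diagonal, Finset.prod_comm]
  simp only [Finset.prod_pow_eq_pow_sum, BoundedExponent.sum_apply, Finset.prod_pow]

lemma linProd_transvection [DecidableEq ι] (i j : ι) (c : A) (α : ι →₀ ℕ) :
    linProd (Matrix.transvection i j c) α = ∑ k ∈ Finset.range (α i + 1),
      monomial (α.erase i + Finsupp.single i k + Finsupp.single j (α i - k))
        (c ^ (α i - k) * ((α i).choose k)) := by
  have hrow : ∀ k, (∑ m, C (Matrix.transvection i j c k m) * X m : MvPolynomial ι A) =
      X k + if k = i then C c * X j else 0 := by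
    intro k
    have : ∀ m, (C (Matrix.transvection i j c k m) * X m : MvPolynomial ι A) =
        (if k = m then X m else 0) + if i = k ∧ j = m then C c * X m else 0 := by
      intro m
      simp only [Matrix.transvection, Matrix.add_apply, Matrix.one_apply, Matrix.single_apply]
      split_ifs <;> simp [add_mul]
    simp only [this, Finset.sum_add_distrib, Finset.sum_ite_eq, Finset.mem_univ, if_true]
    by_cases h : k = i
    · simp [h]
    · simp [h, Ne.symm h]
  have herase : (monomial (α.erase i) 1 : MvPolynomial ι A) =
      ∏ k ∈ Finset.univ.erase i, X k ^ α k := by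
    rw [monomial_eq, Finsupp.prod_fintype _ _ (by simp), C_1, one_mul,
      ← Finset.mul_prod_erase _ _ (Finset.mem_univ i)]
    simp only [Finsupp.erase_same, pow_zero, one_mul]
    exact Finset.prod_congr rfl fun k hk => by rw [Finsupp.erase_ne (Finset.ne_of_mem_erase hk)]
  rw [linProd, ← Finset.mul_prod_erase _ _ (Finset.mem_univ i)]
  have : ∏ k ∈ Finset.univ.erase i, (∑ m, C (Matrix.transvection i j c k m) * X m) ^ α k =
      (monomial (α.erase i) 1 : MvPolynomial ι A) := by
    rw [herase]
    refine Finset.prod_congr rfl fun k hk => ?_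
    rw [hrow, if_neg (Finset.ne_of_mem_erase hk), add_zero]
  rw [this, hrow, if_pos rfl, add_pow, Finset.sum_mul]
  refine Finset.sum_congr rfl fun k _ => ?_
  rw [mul_pow, ← C_pow, X_pow_eq_monomial, X_pow_eq_monomial, C_mul_monomial, monomial_mul,
    ← map_natCast (C : A →+* MvPolynomial ι A), mul_comm _ (C _), C_mul_monomial, monomial_mul]
  congr 1
  · congr 1
    abel
  · ring

/-- Replacing `X i` by `X i + c * X j` sends a monomial to itself plus monomials with a smaller
exponent of `X i`. The matrix is therefore unitriangular for that exponent, whatever the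
characteristic. -/
lemma det_substMatrix_transvection [DecidableEq ι] {i j : ι} (hij : i ≠ j) (c : A) :
    (substMatrix l (Matrix.transvection i j c)).det = 1 := by
  classical
  have key : ∀ α β : BoundedExponent ι l, α.1 i ≤ β.1 i →
      substMatrix l (Matrix.transvection i j c) α β = if α = β then 1 else 0 := by
    intro α β h
    rw [substMatrix, Matrix.of_apply, linProd_transvection, coeff_sum,
      Finset.sum_eq_single (α.1 i)]
    · rw [Nat.sub_self, Finsupp.single_zero, add_zero, Finsupp.erase_add_single, coeff_monomial]
      simp [Subtype.ext_iff]
    · intro k hk hne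
      rw [coeff_monomial, if_neg]
      intro hβ
      have := congrArg (fun γ : ι →₀ ℕ => γ i) hβ
      simp only [Finset.mem_range, Finsupp.add_apply, Finsupp.erase_same, zero_add,
        Finsupp.single_eq_same, Finsupp.single_apply, hij.symm, if_false, add_zero] at hk this
      omega
    · simp
  -- The order is reversed because it is the entries with larger exponent of `X i` in the column
  -- that vanish.
  have hbt : (substMatrix l (Matrix.transvection i j c)).BlockTriangular
      fun α => OrderDual.toDual (α.1 i) := by
    intro α β h
    replace h : α.1 i < β.1 i := h
    rw [key α β h.le, if_neg]
    rintro rfl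
    exact h.false
  rw [hbt.det]
  refine Finset.prod_eq_one fun a _ => ?_
  rw [← Matrix.det_one (n := {α : BoundedExponent ι l // OrderDual.toDual (α.1 i) = a})]
  congr 1
  ext α β
  rw [Matrix.toSquareBlock_def, Matrix.of_apply, key]
  · simp [Matrix.one_apply, Subtype.ext_iff]
  · exact le_of_eq (OrderDual.toDual_inj.1 (α.2.trans β.2.symm))

/-- Both sides are multiplicative in `J`, so the diagonal and transvection cases suffice once
entries lie in a field; the domain hypothesis gives the injection into the fraction field. -/
theorem det_substMatrix [IsDomain A] [DecidableEq ι] (J : Matrix ι ι A) :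
    (substMatrix l J).det = J.det ^ (Fintype.card ι + l).choose (Fintype.card ι + 1) := by
  apply IsFractionRing.injective A (FractionRing A)
  rw [RingHom.map_det, map_pow, RingHom.map_det, RingHom.mapMatrix_apply, RingHom.mapMatrix_apply,
    ← substMatrix_map]
  generalize J.map (algebraMap A (FractionRing A)) = J'
  refine Matrix.diagonal_transvection_induction (fun J => (substMatrix l J).det = J.det ^ _) J'
    (fun D _ => det_substMatrix_diagonal l D) (fun t => ?_) fun J K hJ hK => ?_
  · rw [Matrix.TransvectionStruct.det, one_pow]
    exact det_substMatrix_transvection l t.hij t.c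
  · rw [substMatrix_mul, Matrix.det_mul, hJ, hK, Matrix.det_mul, mul_pow]

/-- Adding terms of higher degree to the images of the monomials under a linear substitution does
not change the determinant. -/
lemma det_of_coeff_linProd [IsDomain A] [DecidableEq ι] (J : Matrix ι ι A) (g : A)
    (M : Matrix (BoundedExponent ι l) (BoundedExponent ι l) A)
    (hM : ∀ α β, β.1.degree ≤ α.1.degree → M α β = g * coeff β.1 (linProd J α.1)) :
    M.det = g ^ (Fintype.card ι + l).choose (Fintype.card ι) *
      J.det ^ (Fintype.card ι + l).choose (Fintype.card ι + 1) := by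
  classical
  have h0 : ∀ α β : BoundedExponent ι l, β.1.degree < α.1.degree ∨ α.1.degree < β.1.degree →
      coeff β.1 (linProd J α.1) = 0 := fun α β h =>
    (isHomogeneous_linProd J α.1).coeff_eq_zero (by omega)
  have hb : M.BlockTriangular fun α => α.1.degree := fun α β h => by
    rw [hM α β h.le, h0 α β (.inl h), mul_zero]
  have hb' : (g • substMatrix l J).BlockTriangular fun α => α.1.degree := fun α β h => by
    rw [Matrix.smul_apply, substMatrix, Matrix.of_apply, h0 α β (.inl h), smul_zero]
  -- Both `M` and `g • substMatrix l J` are block triangular for the degree, so only their diagonal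
  -- blocks matter, and these coincide.
  rw [← det_substMatrix, ← BoundedExponent.card, ← Matrix.det_smul, hb.det, hb'.det]
  refine Finset.prod_congr rfl fun d _ => congrArg Matrix.det ?_
  ext α β
  exact hM α β (β.2.trans α.2.symm).le

end MvPolynomial

/-! ### Étale coordinates and Taylor expansion in the ring of principal parts. -/

namespace Algebra
open KaehlerDifferential MvPolynomial

section

variable {k A : Type u} [CommRing k] [CommRing A] [Algebra k A] {ι : Type}

variable (k) in
/-- Elements `x i` of a formally smooth algebra whose differentials are a basis. -/
structure IsCoordinateSystem (x : ι → A) : Prop where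
  formallySmooth : FormallySmooth k A
  exists_basis : ∃ b : Module.Basis ι A Ω[A⁄k], ∀ i, b i = D k A (x i)

/-- In the Jacobi–Zariski sequence of `k → k[X] → A` the map `A ⊗ Ω[k[X]] → Ω[A]` carries a basis to
a basis, and `H1Cotangent k A` vanishes by formal smoothness. Both obstructions for `A` over `k[X]`
are therefore zero. -/
lemma IsCoordinateSystem.formallyEtale {x : ι → A} (hx : IsCoordinateSystem k x)
    [Algebra (MvPolynomial ι k) A] [IsScalarTower k (MvPolynomial ι k) A]
    (h : ∀ i, algebraMap (MvPolynomial ι k) A (X i) = x i) :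
    FormallyEtale (MvPolynomial ι k) A := by
  obtain ⟨hs, b, hb⟩ := hx
  let b' := (mvPolynomialBasis k ι).baseChange A
  have hmap : ∀ i, mapBaseChange k (MvPolynomial ι k) A (b' i) = b i := by
    intro i
    have : mvPolynomialBasis k ι i = D k _ (X i) := by
      apply (mvPolynomialBasis k ι).repr.injective
      rw [Module.Basis.repr_self, mvPolynomialBasis_repr_D_X]
    simp only [b', Module.Basis.baseChange_apply, mapBaseChange_tmul, this, map_D, one_smul, h, hb]
  have hbij : Function.Bijective (mapBaseChange k (MvPolynomial ι k) A) := by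
    have : mapBaseChange k (MvPolynomial ι k) A = (b'.equiv b (Equiv.refl ι)).toLinearMap :=
      b'.ext fun i => by simp [hmap]
    rw [this]
    exact (b'.equiv b (Equiv.refl ι)).bijective
  have h1 : Subsingleton Ω[A⁄MvPolynomial ι k] := by
    refine ⟨fun y z => ?_⟩
    have h0 : ∀ y : Ω[A⁄MvPolynomial ι k], y = 0 := fun y => by
      obtain ⟨y, rfl⟩ := KaehlerDifferential.map_surjective k (MvPolynomial ι k) A y
      exact (exact_mapBaseChange_map k (MvPolynomial ι k) A y).2 (hbij.2 y)
    rw [h0 y, h0 z]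
  have h2 : Subsingleton (H1Cotangent (MvPolynomial ι k) A) := by
    refine ⟨fun y z => ?_⟩
    have h0 : ∀ y : H1Cotangent (MvPolynomial ι k) A, y = 0 := fun y => by
      have hy : H1Cotangent.δ k (MvPolynomial ι k) A y = 0 :=
        hbij.1 (((H1Cotangent.exact_δ_mapBaseChange k (MvPolynomial ι k) A _).2 ⟨y, rfl⟩).trans
          (map_zero _).symm)
      obtain ⟨w, rfl⟩ := (H1Cotangent.exact_map_δ k (MvPolynomial ι k) A y).1 hy
      have := FormallySmooth.subsingleton_h1Cotangent (R := k) (A := A)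
      rw [Subsingleton.elim w 0, map_zero]
    rw [h0 y, h0 z]
  exact ⟨h1, h2⟩

variable {S C : Type u} [CommRing S] [CommRing C] [Algebra k S] [Algebra k C]

/-- Prescribing the values on coordinates amounts to making `S` an algebra over the polynomial ring;
lifting over that ring is then infinitesimal lifting along `A`. -/
lemma IsCoordinateSystem.exists_lift {x : ι → A} (hx : IsCoordinateSystem k x)
    (π : S →ₐ[k] C) (hπ : Function.Surjective π) (hn : IsNilpotent (RingHom.ker (π : S →+* C)))
    (f : A →ₐ[k] C) (s : ι → S) (hs : ∀ i, π (s i) = f (x i)) :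
    ∃ τ : A →ₐ[k] S, π.comp τ = f ∧ ∀ i, τ (x i) = s i := by
  let := (aeval x : MvPolynomial ι k →ₐ[k] A).toAlgebra
  have : IsScalarTower k (MvPolynomial ι k) A := .of_algebraMap_eq' (aeval x).comp_algebraMap.symm
  let := (aeval s : MvPolynomial ι k →ₐ[k] S).toAlgebra
  have : IsScalarTower k (MvPolynomial ι k) S := .of_algebraMap_eq' (aeval s).comp_algebraMap.symm
  let := (f.comp (aeval x) : MvPolynomial ι k →ₐ[k] C).toAlgebra
  have hA : ∀ i, algebraMap (MvPolynomial ι k) A (X i) = x i := fun i => aeval_X x i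
  have hS : ∀ i, algebraMap (MvPolynomial ι k) S (X i) = s i := fun i => aeval_X s i
  have := hx.formallyEtale hA
  let f' : A →ₐ[MvPolynomial ι k] C := { f with commutes' := fun _ => rfl }
  let π' : S →ₐ[MvPolynomial ι k] C :=
    { π with
      commutes' := fun P => by
        have : π.comp (aeval s) = f.comp (aeval x) := by ext i; simp [hs]
        exact DFunLike.congr_fun this P }
  let τ := FormallySmooth.liftOfSurjective f' π' hπ hn
  refine ⟨τ.restrictScalars k, AlgHom.ext fun a =>
    FormallySmooth.liftOfSurjective_apply f' π' hπ hn a, fun i => ?_⟩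
  rw [← hA, ← hS]
  exact τ.commutes (X i)

omit [Algebra k C] in
lemma IsCoordinateSystem.lift_unique {x : ι → A} (hx : IsCoordinateSystem k x)
    (π : S →+* C) (hn : IsNilpotent (RingHom.ker π)) (τ τ' : A →ₐ[k] S)
    (h : ∀ a, π (τ a) = π (τ' a)) (h' : ∀ i, τ (x i) = τ' (x i)) : τ = τ' := by
  let := (aeval x : MvPolynomial ι k →ₐ[k] A).toAlgebra
  have : IsScalarTower k (MvPolynomial ι k) A := .of_algebraMap_eq' (aeval x).comp_algebraMap.symm
  let := (τ.comp (aeval x) : MvPolynomial ι k →ₐ[k] S).toAlgebra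
  have hA : ∀ i, algebraMap (MvPolynomial ι k) A (X i) = x i := fun i => aeval_X x i
  have := hx.formallyEtale hA
  let σ : A →ₐ[MvPolynomial ι k] S := { τ with commutes' := fun _ => rfl }
  let σ' : A →ₐ[MvPolynomial ι k] S :=
    { τ' with
      commutes' := fun P => by
        have : τ'.comp (aeval x) = τ.comp (aeval x) := by ext i; simp [h']
        exact DFunLike.congr_fun this P }
  have := FormallyUnramified.ext' π hn σ σ' h
  exact AlgHom.ext fun a => DFunLike.congr_fun this a

end

variable {k A B : Type u} [CommRing k] [CommRing A] [Algebra k A] [CommRing B] [Algebra k B]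
  {ι : Type}

/-- `p` and `q` exhibit `B` as the tensor product of `A` with itself over `k`. -/
structure IsSelfCoproduct (p q : A →ₐ[k] B) : Prop where
  exists_desc : ∀ (S : Type u) [CommRing S] [Algebra k S] (f g : A →ₐ[k] S),
    ∃ h : B →ₐ[k] S, h.comp p = f ∧ h.comp q = g
  hom_ext : ∀ (S : Type u) [CommRing S] [Algebra k S] (h h' : B →ₐ[k] S),
    h.comp p = h'.comp p → h.comp q = h'.comp q → h = h'

lemma isNilpotent_ker_of_le {S C : Type u} [CommRing S] [CommRing C] (π : S →+* C) (N : ℕ)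
    (h : ∀ s ∈ RingHom.ker π ^ N, s = 0) : IsNilpotent (RingHom.ker π) :=
  ⟨N, (Submodule.eq_bot_iff _).2 h⟩

/-- For coordinates `x` on `A`, the ring of principal parts of order `l` of `A` is the ring of
polynomials in `q x - p x` truncated in degrees above `l`. -/
theorem IsCoordinateSystem.exists_taylor {x : ι → A} (hx : IsCoordinateSystem k x)
    {p q : A →ₐ[k] B} (hB : IsSelfCoproduct p q) (δ : B →ₐ[k] A) (hp : ∀ a, δ (p a) = a)
    (hq : ∀ a, δ (q a) = a) (l : ℕ) :
    ∃ Φ : B →ₐ[k] MvPolynomial ι A ⧸ idealOfVars ι A ^ (l + 1), Function.Surjective Φ ∧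
      (∀ b, Φ b = 0 ↔ b ∈ RingHom.ker δ ^ (l + 1)) ∧
      (∀ a, Φ (p a) = Ideal.Quotient.mk _ (C a)) ∧
      (∀ i, Φ (q (x i) - p (x i)) = Ideal.Quotient.mk _ (X i)) ∧
      ∀ b ∈ RingHom.ker δ, ∃ P ∈ idealOfVars ι A, Φ b = Ideal.Quotient.mk _ P := by
  set m := idealOfVars ι A
  set J := RingHom.ker δ
  -- The constant term: the polynomial counterpart of restriction to the diagonal `δ`.
  let aug₀ : MvPolynomial ι A →ₐ[A] A := aeval fun _ => 0
  have haug₀ : ∀ P, aug₀ P = 0 ↔ P ∈ m := by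
    intro P
    have h1 : aug₀ P = constantCoeff P := by
      have : aug₀ = AlgHom.mk' constantCoeff (fun c P => by simp [Algebra.smul_def]) := by
        ext i; simp [aug₀]
      rw [this]; rfl
    rw [h1, ← pow_one m, mem_pow_idealOfVars_iff']
    simp [constantCoeff_eq, Finsupp.degree_eq_zero_iff]
  let aug : (MvPolynomial ι A ⧸ m ^ (l + 1)) →ₐ[k] A :=
    Ideal.Quotient.liftₐ (m ^ (l + 1)) (aug₀.restrictScalars k) fun P hP =>
      (haug₀ P).2 (Ideal.pow_le_self (Nat.succ_ne_zero l) hP)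
  have haug_mk : ∀ P, aug (Ideal.Quotient.mk _ P) = aug₀ P := fun P => rfl
  have hker : ∀ s, aug s = 0 → ∃ P ∈ m, s = Ideal.Quotient.mk _ P := by
    intro s hs
    obtain ⟨P, rfl⟩ := Ideal.Quotient.mk_surjective s
    exact ⟨P, (haug₀ P).1 hs, rfl⟩
  have hkermap : RingHom.ker aug ≤ m.map (Ideal.Quotient.mk (m ^ (l + 1))) := by
    intro s hs
    obtain ⟨P, hP, rfl⟩ := hker s hs
    exact Ideal.mem_map_of_mem _ hP
  have hnil : IsNilpotent (RingHom.ker (aug : (MvPolynomial ι A ⧸ m ^ (l + 1)) →+* A)) := by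
    refine isNilpotent_ker_of_le _ (l + 1) fun s hs => ?_
    have : s ∈ (m ^ (l + 1)).map (Ideal.Quotient.mk (m ^ (l + 1))) := by
      rw [Ideal.map_pow]
      exact Ideal.pow_right_mono hkermap _ hs
    rwa [Ideal.map_quotient_self] at this
  let ι₀ : A →ₐ[k] MvPolynomial ι A ⧸ m ^ (l + 1) :=
    (Ideal.Quotient.mkₐ k (m ^ (l + 1))).comp ((Algebra.ofId A (MvPolynomial ι A)).restrictScalars k)
  have hι₀ : ∀ a, ι₀ a = Ideal.Quotient.mk _ (C a) := fun a => rfl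
  -- The Taylor expansion of a function: the lift of the identity of `A` that sends `x i` to `x i +
  -- X i`. With the constants `ι₀` on the first factor it defines the map `Φ`.
  obtain ⟨τ, hτ, hτx⟩ := hx.exists_lift aug (fun a => ⟨ι₀ a, by simp [hι₀, haug_mk, aug₀]⟩) hnil
    (AlgHom.id k A) (fun i => Ideal.Quotient.mk _ (C (x i) + X i)) (fun i => by
      simp [haug_mk, aug₀])
  obtain ⟨Φ, hΦp, hΦq⟩ := hB.exists_desc _ ι₀ τ
  have hΦp' : ∀ a, Φ (p a) = Ideal.Quotient.mk _ (C a) := fun a => DFunLike.congr_fun hΦp a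
  have hΦq' : ∀ a, Φ (q a) = τ a := fun a => DFunLike.congr_fun hΦq a
  have hΦx : ∀ i, Φ (q (x i) - p (x i)) = Ideal.Quotient.mk _ (X i) := fun i => by
    rw [map_sub, hΦp', hΦq', hτx, map_add, add_sub_cancel_left]
  have haugΦ : aug.comp Φ = δ := by
    refine hB.hom_ext _ _ _ (AlgHom.ext fun a => ?_) (AlgHom.ext fun a => ?_)
    · simp [hΦp', hp, haug_mk, aug₀]
    · simp only [AlgHom.comp_apply, hΦq', hq]
      exact DFunLike.congr_fun hτ a
  have hΦJ : ∀ b ∈ J, ∃ P ∈ m, Φ b = Ideal.Quotient.mk _ P := fun b hb =>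
    hker _ ((DFunLike.congr_fun haugΦ b).trans hb)
  -- the inverse map
  let := (p : A →+* B).toAlgebra
  have halg : ∀ a, algebraMap A B a = p a := fun _ => rfl
  have : IsScalarTower k A B := .of_algebraMap_eq fun a => (p.commutes a).symm
  let ψ₀ : MvPolynomial ι A →ₐ[A] B ⧸ J ^ (l + 1) :=
    aeval fun i => Ideal.Quotient.mk _ (q (x i) - p (x i))
  have hξ : ∀ i, q (x i) - p (x i) ∈ J := fun i => by
    rw [RingHom.mem_ker]; simp [hp, hq]
  have hψm : m.map ψ₀ ≤ J.map (Ideal.Quotient.mk (J ^ (l + 1))) := by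
    refine Ideal.map_le_iff_le_comap.2 (Ideal.span_le.2 ?_)
    rintro _ ⟨i, rfl⟩
    simp only [SetLike.mem_coe, Ideal.mem_comap, ψ₀, aeval_X]
    exact Ideal.mem_map_of_mem _ (hξ i)
  have hψ0 : ∀ P ∈ m ^ (l + 1), ψ₀ P = 0 := by
    intro P hP
    have h1 : ψ₀ P ∈ (J ^ (l + 1)).map (Ideal.Quotient.mk (J ^ (l + 1))) := by
      rw [Ideal.map_pow]
      refine Ideal.pow_right_mono hψm _ ?_
      rw [← Ideal.map_pow]
      exact Ideal.mem_map_of_mem _ hP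
    rwa [Ideal.map_quotient_self] at h1
  let Ψ : (MvPolynomial ι A ⧸ m ^ (l + 1)) →ₐ[k] B ⧸ J ^ (l + 1) :=
    Ideal.Quotient.liftₐ (m ^ (l + 1)) (ψ₀.restrictScalars k) hψ0
  have hΨ : ∀ P, Ψ (Ideal.Quotient.mk _ P) = ψ₀ P := fun P => rfl
  let π : B ⧸ J ^ (l + 1) →+* B ⧸ J := Ideal.Quotient.factor (Ideal.pow_le_self (Nat.succ_ne_zero l))
  have hπnil : IsNilpotent (RingHom.ker π) := by
    refine isNilpotent_ker_of_le _ (l + 1) fun s hs => ?_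
    have h1 : RingHom.ker π ≤ J.map (Ideal.Quotient.mk (J ^ (l + 1))) := by
      intro s hs
      obtain ⟨b, rfl⟩ := Ideal.Quotient.mk_surjective s
      exact Ideal.mem_map_of_mem _ (Ideal.Quotient.eq_zero_iff_mem.1 hs)
    have : s ∈ (J ^ (l + 1)).map (Ideal.Quotient.mk (J ^ (l + 1))) := by
      rw [Ideal.map_pow]
      exact Ideal.pow_right_mono h1 _ hs
    rwa [Ideal.map_quotient_self] at this
  have hπψ : ∀ P, π (ψ₀ P) = Ideal.Quotient.mk J (p (aug₀ P)) := by
    intro P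
    have : π.comp (ψ₀ : MvPolynomial ι A →+* B ⧸ J ^ (l + 1)) =
        ((Ideal.Quotient.mk J).comp (p : A →+* B)).comp (aug₀ : MvPolynomial ι A →+* A) := by
      refine MvPolynomial.ringHom_ext (fun a => ?_) fun i => ?_
      · have h1 : ψ₀ (C a) = Ideal.Quotient.mk _ (p a) := ψ₀.commutes a
        have h2 : aug₀ (C a) = a := aug₀.commutes a
        simp only [RingHom.comp_apply, RingHom.coe_coe, h1, h2]
        rfl
      · simp only [RingHom.comp_apply, RingHom.coe_coe, ψ₀, aug₀, aeval_X, map_zero]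
        exact Ideal.Quotient.eq_zero_iff_mem.2 (hξ i)
    exact DFunLike.congr_fun this P
  -- By the universal property of `B` it suffices to compare on the images of `p` and `q`. On `q`,
  -- both maps agree modulo `J` and on the coordinates, so uniqueness of infinitesimal lifts
  -- applies. This identity shows that `Φ` kills nothing outside `J ^ (l + 1)`.
  have hΨΦ : Ψ.comp Φ = Ideal.Quotient.mkₐ k (J ^ (l + 1)) := by
    refine hB.hom_ext _ _ _ (AlgHom.ext fun a => ?_) (hx.lift_unique π hπnil _ _ (fun a => ?_)
      fun i => ?_)
    · simp only [AlgHom.comp_apply, hΦp', hΨ]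
      exact ψ₀.commutes a
    · simp only [AlgHom.comp_apply]
      obtain ⟨P, hP⟩ := Ideal.Quotient.mk_surjective (Φ (q a))
      have h1 : aug₀ P = a := by
        rw [← haug_mk, hP, hΦq']
        exact DFunLike.congr_fun hτ a
      rw [← hP, hΨ, hπψ, h1]
      refine (Ideal.Quotient.eq.2 ?_ : _ = Ideal.Quotient.mk J (q a))
      rw [RingHom.mem_ker]; simp [hp, hq]
    · simp only [AlgHom.comp_apply, hΦq', hτx, hΨ, map_add]
      simp only [ψ₀, aeval_X, map_sub]
      rw [show (C (x i) : MvPolynomial ι A) = algebraMap A _ (x i) from rfl, AlgHom.commutes,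
        IsScalarTower.algebraMap_apply A B, halg]
      simp
  have hΨΦ' : ∀ b, Ψ (Φ b) = Ideal.Quotient.mk _ b := fun b => DFunLike.congr_fun hΨΦ b
  refine ⟨Φ, fun s => ?_, fun b => ⟨fun h => ?_, fun h => ?_⟩, hΦp', hΦx, hΦJ⟩
  · obtain ⟨P, rfl⟩ := Ideal.Quotient.mk_surjective s
    induction P using MvPolynomial.induction_on with
    | C a => exact ⟨p a, hΦp' a⟩
    | add P Q hP hQ =>
      obtain ⟨b, hb⟩ := hP
      obtain ⟨c, hc⟩ := hQ
      exact ⟨b + c, by rw [map_add, hb, hc, map_add]⟩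
    | mul_X P i hP =>
      obtain ⟨b, hb⟩ := hP
      exact ⟨b * (q (x i) - p (x i)), by rw [map_mul, hb, hΦx, map_mul]⟩
  · rw [← Ideal.Quotient.eq_zero_iff_mem, ← hΨΦ', h, map_zero]
  · have h1 : J.map Φ ≤ m.map (Ideal.Quotient.mk (m ^ (l + 1))) := by
      refine Ideal.map_le_iff_le_comap.2 fun b hb => ?_
      obtain ⟨P, hP, h⟩ := hΦJ b hb
      rw [Ideal.mem_comap, h]
      exact Ideal.mem_map_of_mem _ hP
    have : Φ b ∈ (m ^ (l + 1)).map (Ideal.Quotient.mk (m ^ (l + 1))) := by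
      rw [Ideal.map_pow]
      refine Ideal.pow_right_mono h1 _ ?_
      rw [← Ideal.map_pow]
      exact Ideal.mem_map_of_mem _ h
    rwa [Ideal.map_quotient_self] at this

end Algebra

/-! ### Monomial bases of the ring of principal parts and their change of coordinates. -/

namespace MvPolynomial
variable {ι : Type*} [Fintype ι] {A : Type*} [CommRing A]

lemma sub_sum_monomial_mem_pow_idealOfVars (l : ℕ) (P : MvPolynomial ι A) :
    P - ∑ β : BoundedExponent ι l, monomial β.1 (coeff β.1 P) ∈ idealOfVars ι A ^ (l + 1) := by
  classical
  rw [mem_pow_idealOfVars_iff']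
  intro γ hγ
  rw [coeff_sub, coeff_sum, Finset.sum_eq_single ⟨γ, Nat.lt_succ_iff.1 hγ⟩]
  · simp
  · intro β _ hβ
    rw [coeff_monomial, if_neg fun h => hβ (Subtype.ext h)]
  · simp

lemma mk_sum_monomial_bijective (l : ℕ) :
    Function.Bijective fun c : BoundedExponent ι l → A =>
      Ideal.Quotient.mk (idealOfVars ι A ^ (l + 1)) (∑ α, monomial α.1 (c α)) := by
  classical
  constructor
  · intro c c' h
    have h1 := (mem_pow_idealOfVars_iff' _ _).1 (Ideal.Quotient.eq.1 h)
    ext α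
    have h2 := h1 α.1 (Nat.lt_succ_iff.2 α.2)
    have h3 : ∀ c : BoundedExponent ι l → A,
        coeff α.1 (∑ α : BoundedExponent ι l, monomial α.1 (c α)) = c α := by
      intro c
      rw [coeff_sum, Finset.sum_eq_single α]
      · simp
      · intro β _ hβ
        rw [coeff_monomial, if_neg fun h => hβ (Subtype.ext h)]
      · simp
    rw [coeff_sub, h3, h3] at h2
    exact sub_eq_zero.1 h2
  · intro s
    obtain ⟨P, rfl⟩ := Ideal.Quotient.mk_surjective s
    exact ⟨fun α => coeff α.1 P,
      (Ideal.Quotient.eq.2 (sub_sum_monomial_mem_pow_idealOfVars l P)).symm⟩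

end MvPolynomial

namespace Algebra
open KaehlerDifferential MvPolynomial

variable {k A B : Type u} [CommRing k] [CommRing A] [Algebra k A] [CommRing B] [Algebra k B]
  {ι : Type} [Fintype ι]

/-- The monomials in the differences `q (x i) - p (x i)`. -/
def diffMonomial (p q : A →ₐ[k] B) (x : ι → A) (α : ι →₀ ℕ) : B :=
  ∏ i, (q (x i) - p (x i)) ^ α i

/-- The Taylor map carries the monomials in `q (x i) - p (x i)` to the monomial basis of truncated
polynomials. -/
theorem IsCoordinateSystem.bijective_sum_diffMonomial {x : ι → A} (hx : IsCoordinateSystem k x)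
    {p q : A →ₐ[k] B} (hB : IsSelfCoproduct p q) (δ : B →ₐ[k] A) (hp : ∀ a, δ (p a) = a)
    (hq : ∀ a, δ (q a) = a) (l : ℕ) :
    Function.Bijective fun c : BoundedExponent ι l → A =>
      Ideal.Quotient.mk (RingHom.ker δ ^ (l + 1)) (∑ α, p (c α) * diffMonomial p q x α.1) := by
  obtain ⟨Φ, hs, hk, hΦp, hΦx, -⟩ := hx.exists_taylor hB δ hp hq l
  let Φ' : (B ⧸ RingHom.ker δ ^ (l + 1)) →+* MvPolynomial ι A ⧸ idealOfVars ι A ^ (l + 1) :=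
    Ideal.Quotient.lift _ (Φ : B →+* _) fun b hb => (hk b).2 hb
  have hΦ' : Function.Bijective Φ' := by
    constructor
    · rw [injective_iff_map_eq_zero]
      intro s hs
      obtain ⟨b, rfl⟩ := Ideal.Quotient.mk_surjective s
      exact Ideal.Quotient.eq_zero_iff_mem.2 ((hk b).1 hs)
    · intro s
      obtain ⟨b, rfl⟩ := hs s
      exact ⟨Ideal.Quotient.mk _ b, rfl⟩
  rw [← Function.Bijective.of_comp_iff' hΦ']
  refine (congrArg Function.Bijective (funext fun c => ?_)).mp (mk_sum_monomial_bijective l)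
  change _ = Φ _
  simp only [map_sum, map_mul, diffMonomial, map_prod, map_pow, hΦp, hΦx]
  refine Finset.sum_congr rfl fun α _ => ?_
  rw [monomial_eq, Finsupp.prod_fintype _ _ (by simp)]
  simp

/-- The differences `q a - p a` behave like differentials to first order. -/
lemma sub_sub_sum_mem_ker_sq {p q : A →ₐ[k] B} (δ : B →ₐ[k] A) (hp : ∀ a, δ (p a) = a)
    (hq : ∀ a, δ (q a) = a) (x : ι → A) (y : A) (c : ι → A) (h : D k A y = ∑ i, c i • D k A (x i)) :
    (q y - p y) - ∑ i, p (c i) * (q (x i) - p (x i)) ∈ RingHom.ker δ ^ 2 := by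
  let := (p : A →+* B).toAlgebra
  have : IsScalarTower k A B := .of_algebraMap_eq fun a => (p.commutes a).symm
  have hd : ∀ a, q a - p a ∈ RingHom.ker δ := fun a => by
    rw [RingHom.mem_ker]; simp [hp, hq]
  have hsmul : ∀ (a : A) (b : B), a • Ideal.Quotient.mk (RingHom.ker δ ^ 2) b =
      Ideal.Quotient.mk _ (p a * b) := fun a b => by
    rw [Algebra.smul_def, map_mul]; rfl
  -- The map `a ↦ q a - p a` is a derivation modulo the square, with `A` acting through `p`: its
  -- failure of the Leibniz rule is `(q a - p a) * (q b - p b)`. The relation among differentials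
  -- can then be transported by the universal property of `Ω`.
  let d : Derivation k A (B ⧸ RingHom.ker δ ^ 2) :=
    Derivation.mk' ((Ideal.Quotient.mkₐ k (RingHom.ker δ ^ 2)).toLinearMap ∘ₗ
      (q.toLinearMap - p.toLinearMap)) fun a b => by
        simp only [LinearMap.comp_apply, LinearMap.sub_apply, AlgHom.toLinearMap_apply,
          Ideal.Quotient.mkₐ_eq_mk, hsmul, ← map_add]
        rw [Ideal.Quotient.eq, map_mul, map_mul]
        have := Ideal.mul_mem_mul (hd a) (hd b)
        rw [← pow_two] at this
        convert this using 1
        ring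
  have hdapp : ∀ a, d a = Ideal.Quotient.mk _ (q a - p a) := fun a => rfl
  have h1 := congrArg d.liftKaehlerDifferential h
  simp only [map_sum, map_smul, Derivation.liftKaehlerDifferential_comp_D, hdapp, hsmul] at h1
  rw [← map_sum] at h1
  exact Ideal.Quotient.eq.1 h1

omit [Fintype ι] in
-- The Taylor map respects the two adic filtrations, so terms of high order near the diagonal
-- contribute no low-degree coefficients.
lemma mem_ker_pow_expansion {δ : B →ₐ[k] A} {l : ℕ}
    {Φ : B →ₐ[k] MvPolynomial ι A ⧸ idealOfVars ι A ^ (l + 1)}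
    (hΦ : ∀ b ∈ RingHom.ker δ, ∃ P ∈ idealOfVars ι A, Φ b = Ideal.Quotient.mk _ P) (d : ℕ)
    {b : B} (hb : b ∈ RingHom.ker δ ^ d) :
    ∃ P ∈ idealOfVars ι A ^ d, Φ b = Ideal.Quotient.mk _ P := by
  have h1 : RingHom.ker δ ≤ ((idealOfVars ι A).map (Ideal.Quotient.mk _)).comap Φ := by
    intro b hb
    obtain ⟨P, hP, h⟩ := hΦ b hb
    rw [Ideal.mem_comap, h]
    exact Ideal.mem_map_of_mem _ hP
  have h2 : Φ b ∈ (idealOfVars ι A ^ d).map (Ideal.Quotient.mk (idealOfVars ι A ^ (l + 1))) := by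
    rw [Ideal.map_pow]
    refine Ideal.pow_right_mono (Ideal.map_le_iff_le_comap.2 h1) d ?_
    rw [← Ideal.map_pow]
    exact Ideal.mem_map_of_mem _ hb
  obtain ⟨P, hP, h⟩ := (Ideal.mem_map_iff_of_surjective _ Ideal.Quotient.mk_surjective).1 h2
  exact ⟨P, hP, h.symm⟩

/-- Factors are replaced one at a time; each replacement trades an element of `I` for one of `I ^ 2`
and so gains one order. -/
lemma prod_pow_sub_prod_pow_mem {I : Ideal B} {a b : ι → B} (ha : ∀ i, a i ∈ I)
    (hb : ∀ i, b i ∈ I) (hab : ∀ i, a i - b i ∈ I ^ 2) (α : ι →₀ ℕ) :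
    ∏ i, a i ^ α i - ∏ i, b i ^ α i ∈ I ^ (α.degree + 1) := by
  classical
  have hpow : ∀ i n, a i ^ n - b i ^ n ∈ I ^ (n + 1) := by
    intro i n
    induction n with
    | zero => simp
    | succ n ih =>
      have h1 : a i ^ (n + 1) - b i ^ (n + 1) =
        (a i ^ n - b i ^ n) * a i + b i ^ n * (a i - b i) := by ring
      rw [h1]
      refine add_mem ?_ ?_
      · rw [pow_succ]; exact Ideal.mul_mem_mul ih (ha i)
      · rw [show n + 1 + 1 = n + 2 by ring, pow_add]
        exact Ideal.mul_mem_mul (Ideal.pow_mem_pow (hb i) n) (hab i)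
  have hprod : ∀ (c : ι → B), (∀ i, c i ∈ I) → ∀ s : Finset ι,
      ∏ i ∈ s, c i ^ α i ∈ I ^ (∑ i ∈ s, α i) := by
    intro c hc s
    rw [← Finset.prod_pow_eq_pow_sum]
    exact Ideal.prod_mem_prod fun i _ => Ideal.pow_mem_pow (hc i) _
  rw [Finsupp.degree_eq_sum]
  generalize (Finset.univ : Finset ι) = s
  induction s using Finset.induction_on with
  | empty => simp
  | insert i s his ih =>
    rw [Finset.prod_insert his, Finset.prod_insert his, Finset.sum_insert his]
    have h1 : ∀ u v w z : B, u * v - w * z = (u - w) * v + w * (v - z) := by intros; ring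
    rw [h1]
    refine add_mem ?_ ?_
    · rw [show α i + ∑ j ∈ s, α j + 1 = (α i + 1) + ∑ j ∈ s, α j by ring, pow_add]
      exact Ideal.mul_mem_mul (hpow i _) (hprod a ha s)
    · rw [add_assoc, pow_add]
      exact Ideal.mul_mem_mul (Ideal.pow_mem_pow (hb i) _) ih

/-- The matrix expressing the monomials in the differences of one coordinate system in terms of
those of another one, and its determinant. -/
theorem IsCoordinateSystem.exists_transition [IsDomain A] [DecidableEq ι]
    {x : ι → A} (hx : IsCoordinateSystem k x)
    {p q : A →ₐ[k] B} (hB : IsSelfCoproduct p q) (δ : B →ₐ[k] A) (hp : ∀ a, δ (p a) = a)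
    (hq : ∀ a, δ (q a) = a) (l : ℕ) (y : ι → A) (G : Matrix ι ι A)
    (hy : ∀ i, D k A (y i) = ∑ j, G i j • D k A (x j)) (g : A) :
    ∃ M : Matrix (BoundedExponent ι l) (BoundedExponent ι l) A,
      M.det = g ^ (Fintype.card ι + l).choose (Fintype.card ι) *
        G.det ^ (Fintype.card ι + l).choose (Fintype.card ι + 1) ∧
      ∀ α, q g * diffMonomial p q y α.1 - ∑ β, p (M α β) * diffMonomial p q x β.1 ∈
        RingHom.ker δ ^ (l + 1) := by
  obtain ⟨Φ, hs, hk, hΦp, hΦx, hΦJ⟩ := hx.exists_taylor hB δ hp hq l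
  have hd : ∀ a, q a - p a ∈ RingHom.ker δ := fun a => by
    rw [RingHom.mem_ker]; simp [hp, hq]
  let w : ι → B := fun i => ∑ j, p (G i j) * (q (x j) - p (x j))
  have hw : ∀ i, w i ∈ RingHom.ker δ := fun i => sum_mem fun j _ => Ideal.mul_mem_left _ _ (hd _)
  -- Leading term of the new basis element: replacing `q g` by `p g` and each `q (y i) - p (y i)` by
  -- its linear part `w i` changes only terms of order above `α.degree`.
  have h1 : ∀ α : BoundedExponent ι l,
      q g * diffMonomial p q y α.1 - p g * ∏ i, w i ^ α.1 i ∈ RingHom.ker δ ^ (α.1.degree + 1) := by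
    intro α
    have e : ∀ u v : B, q g * u - p g * v = (q g - p g) * u + p g * (u - v) := by intros; ring
    rw [e]
    refine add_mem ?_ (Ideal.mul_mem_left _ _ (prod_pow_sub_prod_pow_mem (fun i => hd _) hw
      (fun i => sub_sub_sum_mem_ker_sq δ hp hq x (y i) (G i) (hy i)) α.1))
    rw [add_comm, pow_add, pow_one]
    refine Ideal.mul_mem_mul (hd g) ?_
    rw [diffMonomial, Finsupp.degree_eq_sum, ← Finset.prod_pow_eq_pow_sum]
    exact Ideal.prod_mem_prod fun i _ => Ideal.pow_mem_pow (hd _) _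
  choose R hR hR' using fun α : BoundedExponent ι l => mem_ker_pow_expansion hΦJ _ (h1 α)
  let P (α : BoundedExponent ι l) : MvPolynomial ι A := C g * linProd G α.1 + R α
  have hΦw : ∀ α : ι →₀ ℕ, Φ (p g * ∏ i, w i ^ α i) =
      Ideal.Quotient.mk _ (C g * linProd G α) := by
    intro α
    simp only [w, linProd, map_mul, map_prod, map_pow, map_sum, hΦp, hΦx]
  have hP : ∀ α, Φ (q g * diffMonomial p q y α.1) = Ideal.Quotient.mk _ (P α) := by
    intro α
    rw [map_add, ← hΦw, ← hR', ← map_add, add_sub_cancel]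
  -- The remainder `R α` has no terms of degree at most `α.degree`, so it does not affect the
  -- entries on which the determinant depends.
  refine ⟨Matrix.of fun α β => coeff β.1 (P α), det_of_coeff_linProd l G g _ fun α β h => ?_,
    fun α => ?_⟩
  · simp only [Matrix.of_apply, P, coeff_add, coeff_C_mul]
    rw [(mem_pow_idealOfVars_iff' _ _).1 (hR α) β.1 (Nat.lt_succ_iff.2 h), add_zero]
  · rw [← hk, map_sub, hP]
    simp only [map_sum, map_mul, hΦp, Matrix.of_apply, diffMonomial, map_prod, map_pow, hΦx]
    refine Eq.trans ?_ (Ideal.Quotient.eq_zero_iff_mem.2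
      (sub_sum_monomial_mem_pow_idealOfVars l (P α)))
    rw [map_sub, map_sum]
    refine congrArg _ (Finset.sum_congr rfl fun β _ => ?_)
    rw [monomial_eq, Finsupp.prod_fintype _ _ (by simp)]
    simp

end Algebra

/-! ### The number of coordinates equals the dimension. -/

/-- Lying over and going up lift chains of primes from `R`; incomparability keeps chains from `S`
strict after contraction. -/
lemma ringKrullDim_eq_of_isIntegral_of_injective {R S : Type*} [CommRing R] [CommRing S]
    [Algebra R S] [Algebra.IsIntegral R S] (h : Function.Injective (algebraMap R S)) :
    ringKrullDim R = ringKrullDim S := by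
  refine le_antisymm (iSup_le fun p => ?_) (Order.krullDim_le_of_strictMono
    (PrimeSpectrum.comap (algebraMap R S)) fun I J hIJ => Ideal.IsIntegral.comap_lt_comap hIJ)
  have : FaithfulSMul R S := (faithfulSMul_iff_algebraMap_injective R S).2 h
  obtain ⟨⟨P, hP, hP'⟩⟩ := Ideal.nonempty_primesOver (S := S) p.head.asIdeal
  obtain ⟨L, hL, -⟩ := Ideal.exists_ltSeries_of_hasGoingUp p P
  rw [← hL]
  exact le_iSup (fun L : LTSeries (PrimeSpectrum S) => (L.length : WithBot ℕ∞)) L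

lemma MvPolynomial.isTranscendenceBasis_X' {ι k : Type*} [Field k] :
    IsTranscendenceBasis k (X : ι → MvPolynomial ι k) := by
  refine isTranscendenceBasis_iff_algebraicIndependent_isAlgebraic.2 ⟨algebraicIndependent_X ι k, ?_⟩
  rw [adjoin_range_X]
  exact ⟨fun a => isAlgebraic_algebraMap (⟨a, trivial⟩ : (⊤ : Subalgebra k (MvPolynomial ι k)))⟩

/-- The dimension of a finitely generated domain over a field is the cardinality of a
transcendence basis. -/
lemma IsTranscendenceBasis.ringKrullDim_eq {k A ι : Type*} [Field k] [CommRing A] [IsDomain A]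
    [Algebra k A] [Algebra.FiniteType k A] [Fintype ι] {x : ι → A}
    (hx : IsTranscendenceBasis k x) : ringKrullDim A = Fintype.card ι := by
  -- Noether normalization gives the dimension as the size of one transcendence basis, and all
  -- transcendence bases have the same size.
  obtain ⟨s, g, hg, hg'⟩ := exists_integral_inj_algHom_of_fg k A
  let := g.toAlgebra
  have : IsScalarTower k (MvPolynomial (Fin s) k) A := .of_algebraMap_eq' g.comp_algebraMap.symm
  have : Algebra.IsIntegral (MvPolynomial (Fin s) k) A := ⟨hg'⟩
  have : FaithfulSMul (MvPolynomial (Fin s) k) A := (faithfulSMul_iff_algebraMap_injective _ _).2 hg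
  have hy := (MvPolynomial.isTranscendenceBasis_X' (ι := Fin s) (k := k)).algebraMap_comp (A := A)
  have hc := hx.lift_cardinalMk_eq hy
  rw [← ringKrullDim_eq_of_isIntegral_of_injective hg,
    MvPolynomial.ringKrullDim_of_isNoetherianRing, ringKrullDim_eq_zero_of_field, zero_add]
  simp only [Cardinal.mk_fintype, Cardinal.lift_natCast, Nat.cast_inj] at hc
  rw [hc]
  simp

namespace Algebra

open MvPolynomial

/-- As `A` is étale over the polynomial ring, the extension of fraction fields is unramified, hence
separable algebraic. The coordinates therefore form a transcendence basis. -/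
lemma IsCoordinateSystem.ringKrullDim_eq {k A : Type u} [Field k] [CommRing A] [IsDomain A]
    [Algebra k A] [FiniteType k A] {ι : Type} [Fintype ι] {x : ι → A}
    (hx : IsCoordinateSystem k x) : ringKrullDim A = Fintype.card ι := by
  let := (aeval x : MvPolynomial ι k →ₐ[k] A).toAlgebra
  have : IsScalarTower k (MvPolynomial ι k) A := .of_algebraMap_eq' (aeval x).comp_algebraMap.symm
  have := hx.formallyEtale fun i => aeval_X x i
  have : FiniteType (MvPolynomial ι k) A := .of_restrictScalars_finiteType k _ A
  have : FinitePresentation (MvPolynomial ι k) A := .of_finiteType.1 inferInstance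
  have : Smooth (MvPolynomial ι k) A := {}
  have : FaithfulSMul (MvPolynomial ι k) A := inferInstance
  let K := FractionRing (MvPolynomial ι k)
  let F := FractionRing A
  have : FaithfulSMul (MvPolynomial ι k) F := .trans _ A _
  let := FractionRing.liftAlgebra (MvPolynomial ι k) F
  have : FormallyUnramified A F := .of_isLocalization (nonZeroDivisors A)
  have : FormallyUnramified (MvPolynomial ι k) F := .comp _ A _
  have : FormallyUnramified K F := .of_restrictScalars (MvPolynomial ι k) K F
  have : EssFiniteType A F := .of_isLocalization _ (nonZeroDivisors A)
  have : EssFiniteType (MvPolynomial ι k) F := .comp _ A _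
  have : EssFiniteType K F := .of_comp (MvPolynomial ι k) K F
  have : Algebra.IsSeparable K F := FormallyUnramified.isSeparable K F
  have : Algebra.IsAlgebraic (MvPolynomial ι k) F :=
    (IsFractionRing.comap_isAlgebraic_iff (K := K)).2 inferInstance
  have : Algebra.IsAlgebraic (MvPolynomial ι k) A := ⟨fun a =>
    (isAlgebraic_algebraMap_iff (IsFractionRing.injective A F)).1 (Algebra.IsAlgebraic.isAlgebraic _)⟩
  exact ((isTranscendenceBasis_X' (ι := ι) (k := k)).algebraMap_comp (A := A)).ringKrullDim_eq

end Algebra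

open Topology in
-- A neighbourhood of a point of the smallest member of a chain meets every member, and intersecting
-- with it keeps the chain strict.
lemma topologicalKrullDim_eq_of_locally {X : Type*} [TopologicalSpace X] [Nonempty X]
    {d : WithBot ℕ∞}
    (h : ∀ x : X, ∃ U : Set X, IsOpen U ∧ x ∈ U ∧ topologicalKrullDim U = d) :
    topologicalKrullDim X = d := by
  apply le_antisymm
  · refine iSup_le fun p => ?_
    obtain ⟨x, hx⟩ := p.head.isIrreducible.nonempty
    obtain ⟨U, hU, hxU, rfl⟩ := h x
    let e := IrreducibleCloseds.orderIsoOfIsOpenEmbedding (Subtype.val : U → X)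
      hU.isOpenEmbedding_subtypeVal
    have hp : ∀ i, ((Subtype.val : U → X) ⁻¹' (p i : Set X)).Nonempty := fun i =>
      ⟨⟨x, hxU⟩, LTSeries.head_le p i hx⟩
    let p' : LTSeries (IrreducibleCloseds U) :=
      { length := p.length
        toFun := fun i => e.symm ⟨p i, hp i⟩
        step := fun i => e.symm.strictMono (p.step i) }
    exact le_iSup (fun L : LTSeries (IrreducibleCloseds U) => (L.length : WithBot ℕ∞)) p'
  · obtain ⟨U, hU, hxU, rfl⟩ := h (Classical.arbitrary X)
    exact topologicalKrullDim_subspace_le X U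

/-! ### Existence of local coordinates on smooth schemes. -/

namespace Algebra
open KaehlerDifferential

lemma IsCoordinateSystem.map {k A A' : Type u} [CommRing k] [CommRing A] [Algebra k A] [CommRing A']
    [Algebra k A'] [Algebra A A'] [IsScalarTower k A A'] [FormallyEtale A A'] {ι : Type} {x : ι → A}
    (hx : IsCoordinateSystem k x) : IsCoordinateSystem k fun i => algebraMap A A' (x i) := by
  obtain ⟨h, b, hb⟩ := hx
  refine ⟨.comp k A A', (b.baseChange A').map (tensorKaehlerEquivOfFormallyEtale k A A'),
    fun i => ?_⟩
  rw [Module.Basis.map_apply, Module.Basis.baseChange_apply, hb,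
    tensorKaehlerEquivOfFormallyEtale_apply, mapBaseChange_tmul, one_smul, map_D]

lemma IsCoordinateSystem.reindex {k A : Type u} [CommRing k] [CommRing A] [Algebra k A]
    {ι ι' : Type} {x : ι → A} (hx : IsCoordinateSystem k x) (e : ι' ≃ ι) :
    IsCoordinateSystem k (x ∘ e) := by
  obtain ⟨h, b, hb⟩ := hx
  exact ⟨h, b.reindex e.symm, fun i => by simp [hb]⟩

/-- In a submersive presentation the variables not paired with a relation have differentials forming
a basis. -/
lemma IsStandardSmooth.exists_isCoordinateSystem (k A : Type u) [CommRing k] [CommRing A]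
    [Algebra k A] [IsStandardSmooth k A] : ∃ (m : ℕ) (x : Fin m → A), IsCoordinateSystem k x := by
  obtain ⟨ι, σ, _, _, ⟨P⟩⟩ := IsStandardSmooth.out (R := k) (S := A)
  have h : IsCoordinateSystem k fun i : ((Set.range P.map)ᶜ : Set _) => P.val i :=
    ⟨inferInstance, P.basisKaehler, fun i => by simp⟩
  exact ⟨_, _, h.reindex (Finite.equivFin _).symm⟩

end Algebra

namespace AlgebraicGeometry.Scheme
variable {X : Scheme.{u}} {k : Type u} [Field k] (f : X ⟶ Spec (CommRingCat.of k))

/-- The `k`-algebra of functions on an open subset of a `k`-scheme. -/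
abbrev sectionsAlgebra (U : X.Opens) : Algebra k Γ(X, U) :=
  ((structureMap f).app (op U)).hom.toAlgebra

lemma sectionsAlgebra_eq_appLE (U : X.Opens) :
    (structureMap f).app (op U) = (ΓSpecIso (CommRingCat.of k)).inv ≫ f.appLE ⊤ U le_top := rfl

lemma fres_structureMap {V U : X.Opens} (h : V ≤ U) (c : k) :
    fres h ((structureMap f).app (op U) c) = (structureMap f).app (op V) c :=
  congr($((structureMap f).naturality (homOfLE h).op) c).symm

lemma fres_etale {V U : X.Opens} (hV : IsAffineOpen V) (hU : IsAffineOpen U) (h : V ≤ U) :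
    (fres h).Etale := by
  have h1 := HasRingHomProperty.appLE (P := @Etale) (𝟙 X) inferInstance ⟨U, hU⟩ ⟨V, hV⟩ h
  have h2 : Hom.appLE (𝟙 X) U V h = X.presheaf.map (homOfLE h).op := by
    simp only [Hom.appLE, Hom.id_app]
    exact Category.id_comp _
  rw [h2] at h1
  exact h1

/-- Functions on an open subset which are local coordinates. -/
def IsChart (U : X.Opens) {ι : Type} (x : ι → Γ(X, U)) : Prop :=
  letI := sectionsAlgebra f U
  Algebra.IsCoordinateSystem k x

variable {f}

lemma IsChart.fres {V U : X.Opens} {ι : Type} {x : ι → Γ(X, U)} (hx : IsChart f U x)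
    (hU : IsAffineOpen U) (hV : IsAffineOpen V) (h : V ≤ U) :
    IsChart f V fun i => Scheme.fres h (x i) := by
  let := sectionsAlgebra f U
  let := sectionsAlgebra f V
  let := (Scheme.fres h).toAlgebra
  have : IsScalarTower k Γ(X, U) Γ(X, V) :=
    .of_algebraMap_eq fun c => (fres_structureMap f h c).symm
  have : Algebra.Etale Γ(X, U) Γ(X, V) := fres_etale hV hU h
  exact Algebra.IsCoordinateSystem.map (A' := Γ(X, V)) (x := x) hx

variable (f)

lemma exists_isChart [Smooth f] (x : X) : ∃ (U : X.Opens) (_ : IsAffineOpen U) (_ : x ∈ U) (m : ℕ)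
    (y : Fin m → Γ(X, U)), IsChart f U y := by
  obtain ⟨W, hW, U, hU, hx, e, h⟩ := Smooth.exists_isStandardSmooth f x
  -- The spectrum of a field has one point.
  obtain rfl : W = ⊤ := by
    ext y
    have : Subsingleton (Spec (CommRingCat.of k)) :=
      inferInstanceAs (Subsingleton (PrimeSpectrum k))
    simpa [Subsingleton.elim y (f x)] using e hx
  let := sectionsAlgebra f U
  have h1 : RingHom.IsStandardSmooth ((structureMap f).app (op U)).hom :=
    RingHom.isStandardSmooth_respectsIso.2 _ (ΓSpecIso (CommRingCat.of k)).symm.commRingCatIsoToRingEquiv h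
  have : Algebra.IsStandardSmooth k Γ(X, U) := h1
  obtain ⟨m, y, hy⟩ := Algebra.IsStandardSmooth.exists_isCoordinateSystem k Γ(X, U)
  exact ⟨U, hU, hx, m, y, hy⟩

variable {f}

lemma IsChart.ringKrullDim_eq [IsIntegral X] [LocallyOfFiniteType f] {U : X.Opens} [Nonempty U]
    (hU : IsAffineOpen U) {m : ℕ} {x : Fin m → Γ(X, U)} (hx : IsChart f U x) :
    ringKrullDim Γ(X, U) = m := by
  let := sectionsAlgebra f U
  have h1 := HasRingHomProperty.appLE (P := @LocallyOfFiniteType) f inferInstance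
    ⟨⊤, isAffineOpen_top _⟩ ⟨U, hU⟩ le_top
  have h2 : RingHom.FiniteType ((structureMap f).app (op U)).hom :=
    RingHom.finiteType_respectsIso.2 _ (ΓSpecIso (CommRingCat.of k)).symm.commRingCatIsoToRingEquiv h1
  have : Algebra.FiniteType k Γ(X, U) := h2
  simpa using Algebra.IsCoordinateSystem.ringKrullDim_eq hx

/-- Any two charts meet because `X` is irreducible, and comparing the dimension of a common affine
open shows that they have equally many coordinates. All charts thus have dimension `m`, and so does
`X`. -/
lemma IsChart.eq_of_topologicalKrullDim [IsIntegral X] [LocallyOfFiniteType f] [Smooth f] {n : ℕ}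
    (hn : topologicalKrullDim X = n) {U : X.Opens} [Nonempty U]
    (hU : IsAffineOpen U) {m : ℕ} {x : Fin m → Γ(X, U)} (hx : IsChart f U x) : m = n := by
  have h : ∀ y : X, ∃ V : Set X, IsOpen V ∧ y ∈ V ∧ topologicalKrullDim V = m := by
    intro y
    obtain ⟨V, hV, hyV, m', x', hx'⟩ := exists_isChart f y
    have : Nonempty V := ⟨⟨y, hyV⟩⟩
    obtain ⟨z, hzU, hzV⟩ : (U ∩ V : Set X).Nonempty :=
      nonempty_preirreducible_inter U.2 V.2 (Set.nonempty_coe_sort.1 ‹Nonempty U›) ⟨y, hyV⟩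
    obtain ⟨W, hW, hzW, hWUV⟩ := exists_isAffineOpen_mem_le (U := U ⊓ V) ⟨hzU, hzV⟩
    have : Nonempty W := ⟨⟨z, hzW⟩⟩
    have h1 := (hx.fres hU hW (hWUV.trans inf_le_left)).ringKrullDim_eq hW
    have h2 := (hx'.fres hV hW (hWUV.trans inf_le_right)).ringKrullDim_eq hW
    have h3 := hx'.ringKrullDim_eq hV
    have h4 : m = m' := by exact_mod_cast h1.symm.trans h2
    refine ⟨V, V.2, hyV, ?_⟩
    rw [h4, ← h3, ← PrimeSpectrum.topologicalKrullDim_eq_ringKrullDim]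
    exact IsHomeomorph.topologicalKrullDim_eq hV.isoSpec.hom hV.isoSpec.hom.homeomorph.isHomeomorph
  have h5 := topologicalKrullDim_eq_of_locally h
  exact_mod_cast h5.symm.trans hn

end AlgebraicGeometry.Scheme

/-! ### The cotangent and canonical sheaves in a chart. -/

namespace AlgebraicGeometry.Scheme
open Modules
variable {X : Scheme.{u}} {k : Type u} [Field k] (f : X ⟶ Spec (CommRingCat.of k))

/-- The presheaf `U ↦ Ω_{𝒪(U)/k}`. -/
abbrev differentialsPresheaf : _root_.PresheafOfModules.{u} (X.presheaf ⋙ forget₂ CommRingCat RingCat) :=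
  _root_.PresheafOfModules.DifferentialsConstruction.relativeDifferentials' (structureMap (k := k) f)

/-- The differential of a function in the presheaf of differentials. -/
def presheafD {U : X.Opens} (a : Γ(X, U)) : (differentialsPresheaf f).sectionsModule (op U) :=
  letI := sectionsAlgebra f U
  KaehlerDifferential.D k Γ(X, U) a

lemma res_presheafD {V U : X.Opens} (h : V ≤ U) (a : Γ(X, U)) :
    (differentialsPresheaf f).res (homOfLE h).op (presheafD f a) = presheafD f (fres h a) :=
  CommRingCat.KaehlerDifferential.map_d ((structureMap f).naturality (homOfLE h).op) a

/-- The differential of a function as a section of the cotangent sheaf. -/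
def dSection {U : X.Opens} (a : Γ(X, U)) : Γ(cotangentSheaf f, U) :=
  toOf (differentialsPresheaf f) U (presheafD f a)

lemma mres_dSection {V U : X.Opens} (h : V ≤ U) (a : Γ(X, U)) :
    (cotangentSheaf f).mres h (dSection f a) = dSection f (fres h a) := by
  rw [dSection, dSection, ← res_presheafD f h, toOf_res]
  rfl

lemma dSection_eq_sum {U : X.Opens} {ι : Type} [Fintype ι] (x : ι → Γ(X, U)) (y : Γ(X, U))
    (c : ι → Γ(X, U))
    (h : letI := sectionsAlgebra f U
      KaehlerDifferential.D k Γ(X, U) y = ∑ i, c i • KaehlerDifferential.D k Γ(X, U) (x i)) :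
    dSection f y = ∑ i, c i • dSection f (x i) := by
  refine (congrArg (toOf (differentialsPresheaf f) U) h).trans ?_
  refine (map_sum (toOf (differentialsPresheaf f) U) _ _).trans ?_
  exact Finset.sum_congr rfl fun i _ => (toOf (differentialsPresheaf f) U).map_smul _ _

variable {f}

lemma IsChart.isBasisOn {U : X.Opens} (hU : IsAffineOpen U) {ι : Type} [Fintype ι]
    {x : ι → Γ(X, U)} (hx : IsChart f U x) :
    (cotangentSheaf f).IsBasisOn U fun i => dSection f (x i) := by
  refine isBasisOn_toOf (differentialsPresheaf f) (fun i => presheafD f (x i)) fun V hV hVaff => ?_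
  let := sectionsAlgebra f V
  obtain ⟨-, b, hb⟩ := hx.fres hU hVaff hV
  refine (congrArg Function.Bijective (funext fun c => ?_)).mp b.equivFun.symm.bijective
  rw [Module.Basis.equivFun_symm_apply]
  refine Finset.sum_congr rfl fun i _ => ?_
  rw [res_presheafD, hb]
  rfl

lemma IsChart.isGeneratorOn {U : X.Opens} (hU : IsAffineOpen U) {n : ℕ}
    {x : Fin n → Γ(X, U)} (hx : IsChart f U x) :
    (canonicalSheaf f n).IsGeneratorOn U (wedge fun i => dSection f (x i)) :=
  (hx.isBasisOn hU).wedge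

end AlgebraicGeometry.Scheme

/-! ### Functions on `V × V` and their universal property. -/

namespace AlgebraicGeometry.Scheme
open Modules Limits
variable {X : Scheme.{u}} {k : Type u} [Field k] (f : X ⟶ Spec (CommRingCat.of k))

/-- The open subset `V × V` of `X × X`. -/
abbrev square (V : X.Opens) : (pullback f f).Opens :=
  pullback.fst f f ⁻¹ᵁ V ⊓ pullback.snd f f ⁻¹ᵁ V

variable {f}

lemma isAffineOpen_square {V : X.Opens} (hV : IsAffineOpen V) : IsAffineOpen (square f V) := by
  have : IsAffine V := hV
  -- This open set is the image of an open immersion from a fibre product of affine schemes.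
  have h : square f V = (pullback.map (V.ι ≫ f) (V.ι ≫ f) f f V.ι V.ι (𝟙 _) (by simp)
      (by simp)).opensRange := by
    ext1
    simp [Scheme.Pullback.range_map]
  rw [h]
  exact isAffineOpen_opensRange _

lemma diagonal_preimage_square (V : X.Opens) : pullback.diagonal f ⁻¹ᵁ square f V = V := by
  simp [square, Hom.preimage_inf, ← Hom.comp_preimage]

section
variable {V : X.Opens} (hV : IsAffineOpen V)
include hV

/-- The two ring maps are points of `V` with values in `Spec S`; the morphism they define to the
fibre product lands in the affine open `V × V` and so comes from a ring map. -/
lemma exists_desc_square {S : CommRingCat.{u}} (φ ψ : Γ(X, V) ⟶ S)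
    (h : f.appLE ⊤ V le_top ≫ φ = f.appLE ⊤ V le_top ≫ ψ) :
    ∃ χ : Γ(pullback f f, square f V) ⟶ S,
      (pullback.fst f f).appLE V (square f V) inf_le_left ≫ χ = φ ∧
      (pullback.snd f f).appLE V (square f V) inf_le_right ≫ χ = ψ := by
  have hc : (Spec.map φ ≫ hV.fromSpec) ≫ f = (Spec.map ψ ≫ hV.fromSpec) ≫ f := by
    rw [Category.assoc, Category.assoc, ← (isAffineOpen_top _).SpecMap_appLE_fromSpec f hV le_top,
      ← Spec.map_comp_assoc, ← Spec.map_comp_assoc, h]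
  have hW := isAffineOpen_square (f := f) hV
  have hφ (φ : Γ(X, V) ⟶ S) (y : Spec S) : (Spec.map φ ≫ hV.fromSpec) y ∈ V := by
    have : (Spec.map φ ≫ hV.fromSpec) y ∈ Set.range hV.fromSpec := ⟨Spec.map φ y, rfl⟩
    rwa [hV.range_fromSpec] at this
  have hr : Set.range (pullback.lift _ _ hc) ⊆ Set.range hW.fromSpec := by
    rw [hW.range_fromSpec]
    rintro _ ⟨y, rfl⟩
    refine ⟨?_, ?_⟩
    · have := hφ φ y
      rwa [← pullback.lift_fst _ _ hc] at this
    · have := hφ ψ y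
      rwa [← pullback.lift_snd _ _ hc] at this
  obtain ⟨χ, hχ⟩ := Spec.map_surjective (IsOpenImmersion.lift hW.fromSpec (pullback.lift _ _ hc) hr)
  have hχ' : Spec.map χ ≫ hW.fromSpec = pullback.lift _ _ hc := by
    rw [hχ, IsOpenImmersion.lift_fac]
  refine ⟨χ, ?_, ?_⟩ <;> apply Spec.map_injective <;> rw [← cancel_mono hV.fromSpec] <;>
    rw [Spec.map_comp_assoc, hV.SpecMap_appLE_fromSpec _ hW, reassoc_of% hχ']
  · rw [pullback.lift_fst]
  · rw [pullback.lift_snd]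

lemma hom_ext_square {S : CommRingCat.{u}} {χ χ' : Γ(pullback f f, square f V) ⟶ S}
    (h₁ : (pullback.fst f f).appLE V (square f V) inf_le_left ≫ χ =
      (pullback.fst f f).appLE V (square f V) inf_le_left ≫ χ')
    (h₂ : (pullback.snd f f).appLE V (square f V) inf_le_right ≫ χ =
      (pullback.snd f f).appLE V (square f V) inf_le_right ≫ χ') : χ = χ' := by
  have hW := isAffineOpen_square (f := f) hV
  apply Spec.map_injective
  rw [← cancel_mono hW.fromSpec]
  apply pullback.hom_ext
  · rw [Category.assoc, Category.assoc, ← hV.SpecMap_appLE_fromSpec _ hW inf_le_left,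
      ← Spec.map_comp_assoc, ← Spec.map_comp_assoc, h₁]
  · rw [Category.assoc, Category.assoc, ← hV.SpecMap_appLE_fromSpec _ hW inf_le_right,
      ← Spec.map_comp_assoc, ← Spec.map_comp_assoc, h₂]

end

variable (f)

/-- The `k`-algebra of functions on an open subset of `X × X`. -/
abbrev squareAlgebra (W : (pullback f f).Opens) : Algebra k Γ(pullback f f, W) :=
  sectionsAlgebra (pullback.fst f f ≫ f) W

lemma appLE_structureMap {X Y : Scheme.{u}} (g : Y ⟶ X) (f : X ⟶ Spec (CommRingCat.of k))
    (f' : Y ⟶ Spec (CommRingCat.of k)) (h : g ≫ f = f') {V : X.Opens} {W : Y.Opens}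
    (e : W ≤ g ⁻¹ᵁ V) (c : k) :
    g.appLE V W e ((structureMap f).app (op V) c) = (structureMap f').app (op W) c := by
  subst h
  rw [sectionsAlgebra_eq_appLE, sectionsAlgebra_eq_appLE]
  have := Hom.appLE_comp_appLE g f ⊤ V W le_top e
  rw [← this]
  rfl

/-- Pullback of functions along the first projection. -/
def fstAlgHom (V : X.Opens) :
    letI := sectionsAlgebra f V
    letI := squareAlgebra f (square f V)
    Γ(X, V) →ₐ[k] Γ(pullback f f, square f V) :=
  letI := sectionsAlgebra f V
  letI := squareAlgebra f (square f V)
  { ((pullback.fst f f).appLE V (square f V) inf_le_left).hom with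
    commutes' := appLE_structureMap _ _ _ rfl _ }

/-- Pullback of functions along the second projection. -/
def sndAlgHom (V : X.Opens) :
    letI := sectionsAlgebra f V
    letI := squareAlgebra f (square f V)
    Γ(X, V) →ₐ[k] Γ(pullback f f, square f V) :=
  letI := sectionsAlgebra f V
  letI := squareAlgebra f (square f V)
  { ((pullback.snd f f).appLE V (square f V) inf_le_right).hom with
    commutes' := appLE_structureMap _ _ _ pullback.condition.symm _ }

/-- Restriction of functions to the diagonal. -/
def diagonalAlgHom (V : X.Opens) :
    letI := sectionsAlgebra f V
    letI := squareAlgebra f (square f V)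
    Γ(pullback f f, square f V) →ₐ[k] Γ(X, V) :=
  letI := sectionsAlgebra f V
  letI := squareAlgebra f (square f V)
  { ((pullback.diagonal f).appLE (square f V) V (diagonal_preimage_square V).ge).hom with
    commutes' := appLE_structureMap _ _ _ (by simp) _ }

lemma appLE_of_eq_id {g : X ⟶ X} (h : g = 𝟙 X) (V : X.Opens) (e : V ≤ g ⁻¹ᵁ V) (a : Γ(X, V)) :
    g.appLE V V e a = a := by
  subst h
  exact fres_self a

lemma diagonalAlgHom_fstAlgHom (V : X.Opens) (a : Γ(X, V)) :
    diagonalAlgHom f V (fstAlgHom f V a) = a := by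
  refine congr($(Hom.appLE_comp_appLE (pullback.diagonal f) (pullback.fst f f) V (square f V) V
    inf_le_left (diagonal_preimage_square V).ge) a).trans ?_
  exact appLE_of_eq_id (pullback.diagonal_fst f) _ _ _

lemma diagonalAlgHom_sndAlgHom (V : X.Opens) (a : Γ(X, V)) :
    diagonalAlgHom f V (sndAlgHom f V a) = a := by
  refine congr($(Hom.appLE_comp_appLE (pullback.diagonal f) (pullback.snd f f) V (square f V) V
    inf_le_right (diagonal_preimage_square V).ge) a).trans ?_
  exact appLE_of_eq_id (pullback.diagonal_snd f) _ _ _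

variable {f}

lemma isSelfCoproduct_square {V : X.Opens} (hV : IsAffineOpen V) :
    letI := sectionsAlgebra f V
    letI := squareAlgebra f (square f V)
    Algebra.IsSelfCoproduct (fstAlgHom f V) (sndAlgHom f V) := by
  let := sectionsAlgebra f V
  let := squareAlgebra f (square f V)
  have key {S : Type u} [CommRing S] [Algebra k S] (φ : Γ(X, V) →ₐ[k] S) :
      f.appLE ⊤ V le_top ≫ CommRingCat.ofHom (φ : Γ(X, V) →+* S) =
        (ΓSpecIso (CommRingCat.of k)).hom ≫ CommRingCat.ofHom (algebraMap k S) := by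
    rw [← Iso.inv_comp_eq, ← Category.assoc, ← sectionsAlgebra_eq_appLE]
    ext c
    exact φ.commutes c
  refine ⟨fun S _ _ φ ψ => ?_, fun S _ _ χ χ' h₁ h₂ => ?_⟩
  · obtain ⟨χ, h₁, h₂⟩ := exists_desc_square (f := f) hV (S := CommRingCat.of S) (CommRingCat.ofHom (φ : Γ(X, V) →+* S))
      (CommRingCat.ofHom (ψ : Γ(X, V) →+* S)) ((key φ).trans (key ψ).symm)
    have h₁' (a) : χ (fstAlgHom f V a) = φ a := congr($h₁ a)
    have h₂' (a) : χ (sndAlgHom f V a) = ψ a := congr($h₂ a)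
    refine ⟨{ χ.hom with commutes' := fun c => ?_ }, AlgHom.ext h₁', AlgHom.ext h₂'⟩
    refine Eq.trans ?_ ((h₁' (algebraMap k _ c)).trans (φ.commutes c))
    exact congrArg χ ((fstAlgHom f V).commutes c).symm
  · have := hom_ext_square hV (S := CommRingCat.of S) (χ := CommRingCat.ofHom (χ : Γ(pullback f f, square f V) →+* S))
      (χ' := CommRingCat.ofHom (χ' : Γ(pullback f f, square f V) →+* S))
      (by ext a; exact AlgHom.congr_fun h₁ a) (by ext a; exact AlgHom.congr_fun h₂ a)
    exact AlgHom.ext fun b => congr($this b)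

end AlgebraicGeometry.Scheme

/-! ### Quotients by powers of the diagonal ideal and their support. -/

namespace AlgebraicGeometry.Scheme
open Modules Limits

section
variable {Y : Scheme.{u}} (I : Y.IdealSheafData)

/-- The class of a function modulo an ideal sheaf. -/
def quotientMk (W : Y.Opens) : Γ(Y, W) →+ Γ(I.quotient, W) :=
  (I.subschemeι.app W).hom.toAddMonoidHom

lemma quotientMk_mul (W : Y.Opens) (a b : Γ(Y, W)) :
    quotientMk I W (a * b) = a • quotientMk I W b :=
  (I.subschemeι.app W).hom.map_mul a b

lemma mres_quotientMk {V W : Y.Opens} (h : V ≤ W) (a : Γ(Y, W)) :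
    I.quotient.mres h (quotientMk I W a) = quotientMk I V (fres h a) :=
  congr($((I.subschemeι.naturality (homOfLE h).op).symm) a)

lemma quotientMk_surjective {W : Y.Opens} (hW : IsAffineOpen W) :
    Function.Surjective (quotientMk I W) :=
  I.subschemeι_app_surjective ⟨W, hW⟩

lemma quotientMk_eq_zero_iff {W : Y.Opens} (hW : IsAffineOpen W) (a : Γ(Y, W)) :
    quotientMk I W a = 0 ↔ a ∈ I.ideal ⟨W, hW⟩ := by
  rw [← I.ker_subschemeι_app]
  rfl

lemma subsingleton_quotient {W : Y.Opens} (hW : ∀ y ∈ W, y ∉ I.support) :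
    Subsingleton Γ(I.quotient, W) := by
  have h : I.subschemeι ⁻¹ᵁ W = ⊥ := by
    ext y
    refine ⟨fun hy => ?_, fun hy => hy.elim⟩
    refine (hW _ hy ?_).elim
    have : I.subschemeι y ∈ Set.range I.subschemeι := ⟨y, rfl⟩
    rwa [I.range_subschemeι] at this
  change Subsingleton Γ(I.subscheme, I.subschemeι ⁻¹ᵁ W)
  rw [h]
  infer_instance

lemma Modules.tmul_add {M N : Y.Modules} {U : Y.Opens} (m : Γ(M, U)) (n n' : Γ(N, U)) :
    tmul m (n + n') = tmul m n + tmul m n' := by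
  refine Eq.trans (congrArg (toOf _ U) ?_) (map_add (toOf _ U) _ _)
  exact TensorProduct.tmul_add (R := Γ(Y, U)) (M := Γ(M, U)) (N := Γ(N, U)) m n n'

lemma Modules.subsingleton_tensor (M : Y.Modules) {N : Y.Modules} {W : Y.Opens}
    (hN : ∀ V ≤ W, Subsingleton Γ(N, V)) : Subsingleton Γ(tensor M N, W) := by
  suffices h : ∀ t : Γ(tensor M N, W), t = 0 from ⟨fun a b => (h a).trans (h b).symm⟩
  refine fun t => eq_of_locally_mres_eq _ _ _ fun x hx => ?_
  obtain ⟨V, hV, hxV, n, hn⟩ := toOf_locally_surjective _ t x hx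
  refine ⟨V, hV, hxV, ?_⟩
  have := hN V hV
  have hn0 : n = 0 := by
    have : Subsingleton (TensorProduct Γ(Y, V) Γ(M, V) Γ(N, V)) := inferInstance
    exact Subsingleton.elim (α := TensorProduct Γ(Y, V) Γ(M, V) Γ(N, V)) _ _
  rw [map_zero]
  refine hn.symm.trans ?_
  rw [hn0, map_zero]
  rfl

/-- Sections of a module with support in a subset `Z` extend uniquely from `V` to `U` if
`U ∩ Z ⊆ V`. -/
lemma Modules.mres_bijective_of_subsingleton (T : Y.Modules) {Z : Set Y} (hZ : IsClosed Z)
    (hT : ∀ W : Y.Opens, (∀ y ∈ W, y ∉ Z) → Subsingleton Γ(T, W)) {U V : Y.Opens} (h : V ≤ U)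
    (hUV : ∀ y ∈ U, y ∈ Z → y ∈ V) : Function.Bijective (T.mres h) := by
  let Z' : Y.Opens := ⟨Zᶜ, hZ.isOpen_compl⟩
  constructor
  · intro s t hst
    refine T.eq_of_locally_mres_eq s t fun y hy => ?_
    by_cases hyZ : y ∈ Z
    · exact ⟨V, h, hUV y hy hyZ, hst⟩
    · have := hT (U ⊓ Z') fun y hy => hy.2
      exact ⟨U ⊓ Z', inf_le_left, ⟨hy, hyZ⟩, Subsingleton.elim _ _⟩
  · intro s
    -- Extension by zero: the given section on `V` is glued with `0` off `Z`. They agree on overlaps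
    -- because there the module has no nonzero sections.
    let W : ULift.{u} Bool → Y.Opens := fun b => cond b.down V (U ⊓ Z')
    have hW : ∀ b, W b ≤ U := by rintro ⟨_ | _⟩; exacts [inf_le_left, h]
    have h0 : ∀ b, b = false → ∀ W' ≤ W ⟨b⟩, Subsingleton Γ(T, W') := by
      rintro _ rfl W' hW'
      exact hT W' fun y hy => (hW' hy).2
    let m : ∀ b, Γ(T, W b) := fun b => match b with
      | ⟨true⟩ => s
      | ⟨false⟩ => (0 : Γ(T, U ⊓ Z'))
    obtain ⟨n, hn⟩ := T.exists_mres_eq W hW (fun y hy => by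
      by_cases hyZ : y ∈ Z
      · exact ⟨⟨true⟩, hUV y hy hyZ⟩
      · exact ⟨⟨false⟩, hy, hyZ⟩) m (by
      rintro ⟨_ | _⟩ ⟨_ | _⟩
      · have := h0 false rfl _ (inf_le_left : W ⟨false⟩ ⊓ W ⟨false⟩ ≤ _)
        exact Subsingleton.elim _ _
      · have := h0 false rfl _ (inf_le_left : W ⟨false⟩ ⊓ W ⟨true⟩ ≤ _)
        exact Subsingleton.elim _ _
      · have := h0 false rfl _ (inf_le_right : W ⟨true⟩ ⊓ W ⟨false⟩ ≤ _)
        exact Subsingleton.elim _ _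
      · rfl)
    exact ⟨n, hn ⟨true⟩⟩

end

variable {X : Scheme.{u}} {k : Type u} [Field k] {f : X ⟶ Spec (CommRingCat.of k)}

/-- The support of the kernel is in general the closure of the image; separatedness makes the
diagonal closed. -/
lemma support_diagonalIdeal_pow [IsSeparated f] (l : ℕ) :
    ((diagonalIdeal f ^ (l + 1)).support : Set (pullback f f : Scheme)) =
      Set.range (pullback.diagonal f) := by
  rw [IdealSheafData.support_pow_succ, diagonalIdeal, Hom.support_ker]
  exact (pullback.diagonal f).isClosedEmbedding.isClosed_range.closure_eq

lemma mem_diagonalIdeal_pow_iff [IsSeparated f] {V : X.Opens} (hV : IsAffineOpen V) (l : ℕ)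
    (b : Γ(pullback f f, square f V)) :
    b ∈ (diagonalIdeal f ^ (l + 1)).ideal ⟨square f V, isAffineOpen_square hV⟩ ↔
      letI := sectionsAlgebra f V
      letI := squareAlgebra f (square f V)
      b ∈ RingHom.ker (diagonalAlgHom f V) ^ (l + 1) := by
  let := sectionsAlgebra f V
  let := squareAlgebra f (square f V)
  have h : (diagonalIdeal f).ideal ⟨square f V, isAffineOpen_square hV⟩ =
      RingHom.ker (diagonalAlgHom f V) := by
    rw [diagonalIdeal, Hom.ker_apply]
    ext c
    rw [RingHom.mem_ker, RingHom.mem_ker]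
    have hbij : Function.Bijective (fres (diagonal_preimage_square (f := f) V).ge) := by
      have := mres_bijective_of_eq (structureSheaf X) (diagonal_preimage_square (f := f) V).symm
      exact this
    exact (map_eq_zero_iff _ hbij.1).symm
  rw [← h]
  rfl

/-- The direct image is defined by sections over `V × X`, which need not be affine. The sheaf is
supported on the diagonal, which meets `V × X` inside `V × V`, so the smaller set carries the same
sections. -/
lemma principalParts_mres_bijective [IsSeparated f] (l : ℕ) (M : (pullback f f).Modules)
    (V : X.Opens) :
    Function.Bijective ((tensor M (diagonalIdeal f ^ (l + 1)).quotient).mres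
      (inf_le_left : square f V ≤ pullback.fst f f ⁻¹ᵁ V)) := by
  refine mres_bijective_of_subsingleton _ (Z := Set.range (pullback.diagonal f))
    (pullback.diagonal f).isClosedEmbedding.isClosed_range (fun W hW => ?_) _ ?_
  · refine subsingleton_tensor _ fun W' hW' => subsingleton_quotient _ fun y hy hy' => ?_
    exact hW y (hW' hy) ((support_diagonalIdeal_pow (f := f) l).subset hy')
  · rintro _ hy ⟨x, rfl⟩
    have hx : x ∈ V := by
      change x ∈ pullback.diagonal f ⁻¹ᵁ pullback.fst f f ⁻¹ᵁ V at hy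
      rwa [← Hom.comp_preimage, pullback.diagonal_fst] at hy
    rw [← diagonal_preimage_square (f := f) V] at hx
    exact hx

end AlgebraicGeometry.Scheme

/-! ### Local bases of the sheaf of principal parts. -/

namespace AlgebraicGeometry.Scheme
open Modules Limits
open MvPolynomial (BoundedExponent)

lemma Modules.IsBasisOn.reindex {X : Scheme.{u}} {M : X.Modules} {U : X.Opens} {ι ι' : Type}
    [Fintype ι] [Fintype ι'] {s : ι → Γ(M, U)} (h : M.IsBasisOn U s) (e : ι' ≃ ι) :
    M.IsBasisOn U (s ∘ e) := by
  intro V hV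
  refine (congrArg Function.Bijective (funext fun c => ?_)).mp
    ((h V hV).comp (e.arrowCongr (Equiv.refl Γ(X, V))).bijective)
  refine (e.sum_comp _).symm.trans (Finset.sum_congr rfl fun i _ => ?_)
  simp

variable {X : Scheme.{u}} {k : Type u} [Field k] {f : X ⟶ Spec (CommRingCat.of k)} {L : X.Modules}

section
variable (l : ℕ) {V : X.Opens}

/-- The section `q^* e ⊗ b` over `V × V`. -/
def squareSymbol (e : Γ(L, V)) (b : Γ(pullback f f, square f V)) :
    Γ(tensor ((Modules.pullback (pullback.snd f f)).obj L)
      (diagonalIdeal f ^ (l + 1)).quotient, square f V) :=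
  tmul (((Modules.pullback (pullback.snd f f)).obj L).mres inf_le_right
    (pullbackSection (pullback.snd f f) L e)) (quotientMk _ _ b)

lemma squareSymbol_add (e : Γ(L, V)) (b b' : Γ(pullback f f, square f V)) :
    squareSymbol l e (b + b') = squareSymbol l e b + squareSymbol l e b' := by
  rw [squareSymbol, map_add, tmul_add]
  rfl

lemma squareSymbol_mul (e : Γ(L, V)) (a b : Γ(pullback f f, square f V)) :
    squareSymbol l e (a * b) = a • squareSymbol l e b := by
  rw [squareSymbol, quotientMk_mul, tmul_smul_right]
  rfl

lemma squareSymbol_smul (g : Γ(X, V)) (e : Γ(L, V)) (b : Γ(pullback f f, square f V)) :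
    squareSymbol l (g • e) b =
      squareSymbol l e ((pullback.snd f f).appLE V (square f V) inf_le_right g * b) := by
  rw [squareSymbol_mul, squareSymbol, pullbackSection_smul, mres_smul, tmul_smul_left]
  rfl

lemma mres_squareSymbol {W : X.Opens} (h : W ≤ V) (h' : square f W ≤ square f V) (e : Γ(L, V))
    (b : Γ(pullback f f, square f V)) :
    Modules.mres _ h' (squareSymbol l e b) = squareSymbol l (L.mres h e) (fres h' b) := by
  rw [squareSymbol, mres_tmul, mres_quotientMk, mres_mres, squareSymbol, ← mres_pullbackSection _ _ h,
    mres_mres]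

variable [IsSeparated f]

/-- The isomorphism between sections of the sheaf of principal parts over `V` and sections over
`V × V` of the sheaf of which it is the direct image. -/
def principalPartsEquiv (L : X.Modules) (V : X.Opens) :
    Γ(principalParts f l L, V) ≃+ Γ(tensor ((Modules.pullback (pullback.snd f f)).obj L)
      (diagonalIdeal f ^ (l + 1)).quotient, square f V) :=
  AddEquiv.ofBijective _ (principalParts_mres_bijective l
    ((Modules.pullback (pullback.snd f f)).obj L) V)

lemma principalPartsEquiv_smul (a : Γ(X, V)) (m : Γ(principalParts f l L, V)) :
    principalPartsEquiv l L V (a • m) =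
      (pullback.fst f f).appLE V (square f V) inf_le_left a • principalPartsEquiv l L V m :=
  mres_smul _ inf_le_left ((pullback.fst f f).app V a) m

lemma principalPartsEquiv_mres {W : X.Opens} (h : W ≤ V) (h' : square f W ≤ square f V)
    (m : Γ(principalParts f l L, V)) :
    principalPartsEquiv l L W ((principalParts f l L).mres h m) =
      Modules.mres _ h' (principalPartsEquiv l L V m) :=
  (mres_mres (tensor ((Modules.pullback (pullback.snd f f)).obj L) _)
    ((pullback.fst f f).preimage_mono h) inf_le_left m).trans (mres_mres _ inf_le_left h' m).symm

/-- The principal part with symbol `q^* e ⊗ b`. -/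
def principalPart (e : Γ(L, V)) : Γ(pullback f f, square f V) →+ Γ(principalParts f l L, V) :=
  (principalPartsEquiv l L V).symm.toAddMonoidHom.comp
    (AddMonoidHom.mk' (squareSymbol l e) (squareSymbol_add l e))

lemma principalPartsEquiv_principalPart (e : Γ(L, V)) (b : Γ(pullback f f, square f V)) :
    principalPartsEquiv l L V (principalPart l e b) = squareSymbol l e b :=
  (principalPartsEquiv l L V).apply_symm_apply _

lemma smul_principalPart (e : Γ(L, V)) (a : Γ(X, V)) (b : Γ(pullback f f, square f V)) :
    a • principalPart l e b =
      principalPart l e ((pullback.fst f f).appLE V (square f V) inf_le_left a * b) := by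
  apply (principalPartsEquiv l L V).injective
  rw [principalPartsEquiv_smul, principalPartsEquiv_principalPart,
    principalPartsEquiv_principalPart, squareSymbol_mul]

/-- Rescaling `e` acts through the second projection, whereas the module structure acts through the
first (`smul_principalPart`). The two differ by an element of the diagonal ideal. -/
lemma principalPart_smul (e : Γ(L, V)) (g : Γ(X, V)) (b : Γ(pullback f f, square f V)) :
    principalPart l (g • e) b =
      principalPart l e ((pullback.snd f f).appLE V (square f V) inf_le_right g * b) := by
  apply (principalPartsEquiv l L V).injective
  rw [principalPartsEquiv_principalPart, principalPartsEquiv_principalPart, squareSymbol_smul]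

lemma mres_principalPart {W : X.Opens} (h : W ≤ V) (h' : square f W ≤ square f V) (e : Γ(L, V))
    (b : Γ(pullback f f, square f V)) :
    (principalParts f l L).mres h (principalPart l e b) =
      principalPart l (L.mres h e) (fres h' b) := by
  apply (principalPartsEquiv l L W).injective
  rw [principalPartsEquiv_mres l h h', principalPartsEquiv_principalPart,
    principalPartsEquiv_principalPart, mres_squareSymbol l h]


lemma principalPart_surjective {e : Γ(L, V)} (he : L.IsGeneratorOn V e) (hV : IsAffineOpen V) :
    Function.Surjective (principalPart (f := f) l e) := by
  refine (principalPartsEquiv l L V).symm.surjective.comp ?_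
  exact ((he.pullbackSection (pullback.snd f f)).tmul_bijective _ inf_le_right).2.comp
    (quotientMk_surjective _ (isAffineOpen_square hV))

/-- Tensoring with the generator `q^*e` loses nothing, so vanishing is decided in the quotient of
functions on the affine `V × V`. With surjectivity, this reduces the basis statement to
`bijective_sum_diffMonomial`. -/
lemma principalPart_eq_zero_iff {e : Γ(L, V)} (he : L.IsGeneratorOn V e) (hV : IsAffineOpen V)
    (b : Γ(pullback f f, square f V)) : principalPart l e b = 0 ↔
      letI := sectionsAlgebra f V
      letI := squareAlgebra f (square f V)
      b ∈ RingHom.ker (diagonalAlgHom f V) ^ (l + 1) := by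
  rw [← mem_diagonalIdeal_pow_iff hV l, ← quotientMk_eq_zero_iff]
  rw [← (principalPartsEquiv l L V).map_eq_zero_iff, principalPartsEquiv_principalPart]
  have h := ((he.pullbackSection (pullback.snd f f)).tmul_bijective
    (diagonalIdeal f ^ (l + 1)).quotient (inf_le_right : square f V ≤ _)).1
  have h0 : squareSymbol l e (0 : Γ(pullback f f, square f V)) = 0 :=
    (AddMonoidHom.mk' (squareSymbol l e) (squareSymbol_add l e)).map_zero
  rw [← h0, squareSymbol, squareSymbol, map_zero]
  exact h.eq_iff

end

/-- The monomials in the functions `q^* x - p^* x` on `V × V`. -/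
def squareMonomial (f : X ⟶ Spec (CommRingCat.of k)) {V : X.Opens} {ι : Type} [Fintype ι]
    (x : ι → Γ(X, V)) (α : ι →₀ ℕ) : Γ(pullback f f, square f V) :=
  letI := sectionsAlgebra f V
  letI := squareAlgebra f (square f V)
  Algebra.diffMonomial (fstAlgHom f V) (sndAlgHom f V) x α

lemma fres_appLE {X Y : Scheme.{u}} (g : Y ⟶ X) {V W : X.Opens} {V' W' : Y.Opens}
    (e : V' ≤ g ⁻¹ᵁ V) (e' : W' ≤ g ⁻¹ᵁ W) (h : W ≤ V) (h' : W' ≤ V') (a : Γ(X, V)) :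
    fres h' (g.appLE V V' e a) = g.appLE W W' e' (fres h a) := by
  have h1 := congr($(g.appLE_map e (homOfLE h').op) a)
  have h2 := congr($(g.map_appLE e' (homOfLE h).op) a)
  exact h1.trans h2.symm

lemma fres_squareMonomial {V W : X.Opens} {ι : Type} [Fintype ι] (x : ι → Γ(X, V)) (α : ι →₀ ℕ)
    (h : W ≤ V) (h' : square f W ≤ square f V) :
    fres h' (squareMonomial f x α) = squareMonomial f (fun i => fres h (x i)) α := by
  refine (map_prod (fres h') _ _).trans (Finset.prod_congr rfl fun i _ => ?_)
  refine (map_pow (fres h') _ _).trans (congrArg (· ^ α i) ?_)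
  refine (map_sub (fres h') _ _).trans (congrArg₂ (· - ·) ?_ ?_)
  · exact fres_appLE _ _ _ h h' _
  · exact fres_appLE _ _ _ h h' _

lemma square_mono {V W : X.Opens} (h : W ≤ V) : square f W ≤ square f V :=
  inf_le_inf ((pullback.fst f f).preimage_mono h) ((pullback.snd f f).preimage_mono h)

variable [IsSeparated f] {ι : Type} [Fintype ι]

/-- The principal parts attached to local coordinates `x` and a local section `e` of `L`. -/
def principalPartMonomial (f : X ⟶ Spec (CommRingCat.of k)) [IsSeparated f] (l : ℕ) {V : X.Opens}
    (x : ι → Γ(X, V)) (e : Γ(L, V)) (α : BoundedExponent ι l) : Γ(principalParts f l L, V) :=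
  principalPart l e (squareMonomial f x α.1)

lemma mres_principalPartMonomial (l : ℕ) {V W : X.Opens} (h : W ≤ V) (x : ι → Γ(X, V))
    (e : Γ(L, V)) (α : BoundedExponent ι l) :
    (principalParts f l L).mres h (principalPartMonomial f l x e α) =
      principalPartMonomial f l (fun i => fres h (x i)) (L.mres h e) α := by
  rw [principalPartMonomial, mres_principalPart l h (square_mono h),
    fres_squareMonomial x _ h]
  rfl

lemma sum_smul_principalPartMonomial (l : ℕ) {V : X.Opens} (x : ι → Γ(X, V)) (e : Γ(L, V))
    (c : BoundedExponent ι l → Γ(X, V)) :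
    ∑ α, c α • principalPartMonomial f l x e α = principalPart l e (∑ α,
      (pullback.fst f f).appLE V (square f V) inf_le_left (c α) * squareMonomial f x α.1) := by
  rw [map_sum]
  exact Finset.sum_congr rfl fun α _ => smul_principalPart l e _ _

lemma IsChart.isBasisOn_principalPartMonomial {U : X.Opens} (hU : IsAffineOpen U)
    {x : ι → Γ(X, U)} (hx : IsChart f U x) {e : Γ(L, U)} (he : L.IsGeneratorOn U e) (l : ℕ) :
    (principalParts f l L).IsBasisOn U (principalPartMonomial f l x e) := by
  refine isBasisOn_of_isAffineOpen _ _ fun V hV hVa => ?_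
  simp only [mres_principalPartMonomial]
  replace hx := hx.fres hU hVa hV
  replace he := he.mres hV
  set y := fun i => Scheme.fres hV (x i)
  set e' := L.mres hV e
  simp only [sum_smul_principalPartMonomial]
  let := sectionsAlgebra f V
  let := squareAlgebra f (square f V)
  obtain ⟨inj, surj⟩ := Algebra.IsCoordinateSystem.bijective_sum_diffMonomial hx
    (isSelfCoproduct_square hVa) (diagonalAlgHom f V) (diagonalAlgHom_fstAlgHom f V)
    (diagonalAlgHom_sndAlgHom f V) l
  constructor
  · intro c c' h
    refine inj (Ideal.Quotient.eq.2 ((principalPart_eq_zero_iff l he hVa _).1 ?_))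
    exact (map_sub (principalPart l e') _ _).trans (sub_eq_zero.2 h)
  · intro m
    obtain ⟨b, rfl⟩ := principalPart_surjective l he hVa m
    obtain ⟨c, hc⟩ := surj (Ideal.Quotient.mk _ b)
    refine ⟨c, sub_eq_zero.1 ((map_sub (principalPart l e') _ _).symm.trans ?_)⟩
    exact (principalPart_eq_zero_iff l he hVa _).2 (Ideal.Quotient.eq.1 hc)

end AlgebraicGeometry.Scheme

/-! ### Comparison of transition functions and the conclusion. -/

namespace AlgebraicGeometry.Scheme
open Modules Limits
open MvPolynomial (BoundedExponent)

variable {X : Scheme.{u}} {k : Type u} [Field k] {f : X ⟶ Spec (CommRingCat.of k)} {L : X.Modules}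

/-- The determinant of the sheaf of principal parts and the product of powers of the canonical
sheaf and of `L` have the same transition functions. -/
lemma IsChart.exists_transition [IsIntegral X] [IsSeparated f] {W : X.Opens} [Nonempty W]
    (hW : IsAffineOpen W) {n : ℕ} {x : Fin n → Γ(X, W)} (hx : IsChart f W x)
    (y : Fin n → Γ(X, W)) {e : Γ(L, W)} (he : L.IsGeneratorOn W e) (e' : Γ(L, W)) (l : ℕ)
    {r : ℕ} (σ : Fin r ≃ BoundedExponent (Fin n) l) :
    ∃ u : Γ(X, W),
      wedge (fun i => principalPartMonomial f l y e' (σ i)) =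
        u • wedge (fun i => principalPartMonomial f l x e (σ i)) ∧
      tmul (tpow (M := canonicalSheaf f n) (wedge fun i => dSection f (y i))
          ((n + l).choose (n + 1))) (tpow e' ((n + l).choose n)) =
        u • tmul (tpow (M := canonicalSheaf f n) (wedge fun i => dSection f (x i))
          ((n + l).choose (n + 1))) (tpow e ((n + l).choose n)) := by
  obtain ⟨g, rfl⟩ : ∃ g : Γ(X, W), g • e = e' := by
    obtain ⟨g, hg⟩ := (isGeneratorOn_iff.1 he W le_rfl).2 e'
    rw [mres_self] at hg
    exact ⟨g, hg⟩
  let := sectionsAlgebra f W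
  let := squareAlgebra f (square f W)
  obtain ⟨b, hb⟩ := hx.exists_basis
  -- The Jacobian matrix of the coordinate change.
  let G : Matrix (Fin n) (Fin n) Γ(X, W) := fun i => b.repr (KaehlerDifferential.D k _ (y i))
  have hG : ∀ i, KaehlerDifferential.D k Γ(X, W) (y i) =
      ∑ j, G i j • KaehlerDifferential.D k Γ(X, W) (x j) := by
    intro i
    simp only [← hb]
    exact (b.sum_repr _).symm
  obtain ⟨M, hM, hM'⟩ := Algebra.IsCoordinateSystem.exists_transition hx
    (isSelfCoproduct_square hW) (diagonalAlgHom f W) (diagonalAlgHom_fstAlgHom f W)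
    (diagonalAlgHom_sndAlgHom f W) l y G hG g
  rw [Fintype.card_fin] at hM
  refine ⟨M.det, ?_, ?_⟩
  · have h (α : BoundedExponent (Fin n) l) : principalPartMonomial f l y (g • e) α =
        ∑ β, M α β • principalPartMonomial f l x e β := by
      rw [sum_smul_principalPartMonomial, principalPartMonomial, principalPart_smul]
      refine sub_eq_zero.1 ((map_sub (principalPart l e) _ _).symm.trans ?_)
      exact (principalPart_eq_zero_iff l he hW _).2 (hM' α)
    have h' := wedge_sum_smul ((hx.isBasisOn_principalPartMonomial hW he l).reindex σ)
      (M.submatrix σ σ)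
    rw [Matrix.det_submatrix_equiv_self] at h'
    refine Eq.trans (congrArg wedge (funext fun i => ?_)) h'
    rw [h, ← σ.sum_comp]
    rfl
  · have h : wedge (fun i => dSection f (y i)) = G.det • wedge (fun i => dSection f (x i)) := by
      rw [← wedge_sum_smul (hx.isBasisOn hW)]
      exact congrArg wedge (funext fun i => dSection_eq_sum f x (y i) (G i) (hG i))
    -- The power of `g` is absorbed by the tensor power of `L`, the power of `G.det` by that of the
    -- canonical sheaf; this fixes both exponents in the theorem.
    rw [hM, mul_comm, ← smul_smul, ← tmul_smul_right, ← tmul_smul_left, ← tpow_smul]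
    have h' := tpow_smul (M := canonicalSheaf f n) G.det (wedge fun i => dSection f (x i))
      ((n + l).choose (n + 1))
    exact congrArg (fun t => tmul t _) ((congrArg (fun w => tpow (M := canonicalSheaf f n) w _)
      h).trans h')

lemma mres_wedge_principalPartMonomial [IsSeparated f] {U W : X.Opens} (h : W ≤ U) {ι : Type}
    [Fintype ι] (l : ℕ) (x : ι → Γ(X, U)) (e : Γ(L, U)) {r : ℕ} (σ : Fin r → BoundedExponent ι l) :
    Modules.mres _ h (wedge fun i => principalPartMonomial f l x e (σ i)) =
      wedge fun i => principalPartMonomial f l (fun i => fres h (x i)) (L.mres h e) (σ i) := by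
  simp only [mres_wedge, mres_principalPartMonomial]

lemma mres_tmul_tpow_wedge_dSection {U W : X.Opens} (h : W ≤ U) {n : ℕ} (x : Fin n → Γ(X, U))
    (e : Γ(L, U)) (a r : ℕ) :
    Modules.mres _ h (tmul (tpow (M := canonicalSheaf f n) (wedge fun i => dSection f (x i)) a)
        (tpow e r)) =
      tmul (tpow (M := canonicalSheaf f n) (wedge fun i => dSection f (fres h (x i))) a)
        (tpow (L.mres h e) r) := by
  have h₁ : (canonicalSheaf f n).mres h (wedge fun i => dSection f (x i)) =
      wedge fun i => dSection f (fres h (x i)) :=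
    (mres_wedge h _).trans (congrArg wedge (funext fun i => mres_dSection f h (x i)))
  have h₂ := (mres_tpow (M := canonicalSheaf f n) h (wedge fun i => dSection f (x i)) a).trans
    (congrArg (fun w => tpow (M := canonicalSheaf f n) w a) h₁)
  exact (mres_tmul h _ _).trans (congrArg₂ tmul h₂ (mres_tpow h e r))

lemma exists_isChart_isGeneratorOn [IsIntegral X] [LocallyOfFiniteType f] [Smooth f] {n : ℕ}
    (hn : topologicalKrullDim X = n) (hL : L.IsLineBundle) (x : X) :
    ∃ (U : X.Opens) (y : Fin n → Γ(X, U)) (e : Γ(L, U)), x ∈ U ∧ IsAffineOpen U ∧ IsChart f U y ∧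
      L.IsGeneratorOn U e := by
  obtain ⟨V, hV, hxV, m, y, hy⟩ := exists_isChart f x
  have : Nonempty V := ⟨⟨x, hxV⟩⟩
  obtain rfl := hy.eq_of_topologicalKrullDim hn hV
  obtain ⟨V', hxV', e, he⟩ := hL.exists_isGeneratorOn x
  obtain ⟨U, hU, hxU, hUV⟩ := exists_isAffineOpen_mem_le (U := V ⊓ V') ⟨hxV, hxV'⟩
  exact ⟨U, _, _, hxU, hU, hy.fres hV hU (hUV.trans inf_le_left), he.mres (hUV.trans inf_le_right)⟩

end AlgebraicGeometry.Scheme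

end

theorem mainTheorem7 {k : Type u} [Field k] [IsAlgClosed k] {X : Scheme.{u}}
    (f : X ⟶ Spec (CommRingCat.of k)) [IsIntegral X] [IsSeparated f] [LocallyOfFiniteType f]
    [QuasiCompact f] [Smooth f] (n : ℕ) (hn : topologicalKrullDim X = n)
    (L : X.Modules) (hL : L.IsLineBundle) (l : ℕ) :
    ∃ (hP : (Scheme.principalParts f l L).IsLocallyFreeOfRank ((n + l).choose n)) (a : ℕ),
      (n + 1) * a = l * (n + l).choose n ∧
        Nonempty (Scheme.Modules.det (Scheme.principalParts f l L) hP ≅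
          Scheme.Modules.tensor ((Scheme.canonicalSheaf f n).tensorPower a)
            (L.tensorPower ((n + l).choose n))) := by
  let σ : Fin ((n + l).choose n) ≃ MvPolynomial.BoundedExponent (Fin n) l :=
    (Fintype.equivFinOfCardEq (by rw [MvPolynomial.BoundedExponent.card, Fintype.card_fin])).symm
  choose U y e hxU hU hy he using Scheme.exists_isChart_isGeneratorOn (f := f) hn hL
  have hB (x : X) : (Scheme.principalParts f l L).IsBasisOn (U x)
      fun i => Scheme.principalPartMonomial f l (y x) (e x) (σ i) :=
    ((hy x).isBasisOn_principalPartMonomial (hU x) (he x) l).reindex σ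
  refine ⟨Scheme.Modules.isLocallyFreeOfRank_of_isBasisOn fun x => ⟨U x, hxU x, _, hB x⟩,
    (n + l).choose (n + 1), ?_, ?_⟩
  -- The exponent `(n + l).choose (n + 1)` is visibly an integer and equals `l / (n + 1)` times the
  -- rank.
  · have := Nat.choose_succ_right_eq (n + l) n
    rw [Nat.add_sub_cancel_left] at this
    rw [mul_comm, this, mul_comm]
  · refine Scheme.Modules.nonempty_iso_of_isGeneratorOn U (fun x => ⟨x, hxU x⟩) _ _
      (fun x => (hB x).wedge) (fun x => (((hy x).isGeneratorOn (hU x)).tpow _).tmul ((he x).tpow _))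
      fun i j x hi hj => ?_
    -- Transition functions are compared on affine opens, where chart `j` is still a coordinate
    -- system; chart `i` enters only as a family of functions and a section.
    obtain ⟨W, hW, hxW, hWU⟩ := Scheme.exists_isAffineOpen_mem_le (U := U i ⊓ U j) ⟨hi, hj⟩
    have : Nonempty W := ⟨⟨x, hxW⟩⟩
    have hWi := hWU.trans inf_le_left
    have hWj := hWU.trans inf_le_right
    obtain ⟨u, h₁, h₂⟩ := ((hy j).fres (hU j) hW hWj).exists_transition hW
      (fun t => Scheme.fres hWi (y i t)) ((he j).mres hWj) (L.mres hWi (e i)) l σ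
    refine ⟨W, hWi, hWj, hxW, u, ?_, ?_⟩
    · exact (Scheme.mres_wedge_principalPartMonomial hWi l (y i) (e i) σ).trans
        (h₁.trans (congrArg (u • ·)
          (Scheme.mres_wedge_principalPartMonomial hWj l (y j) (e j) σ).symm))
    · exact (Scheme.mres_tmul_tpow_wedge_dSection hWi (y i) (e i) _ _).trans
        (h₂.trans (congrArg (u • ·)
          (Scheme.mres_tmul_tpow_wedge_dSection hWj (y j) (e j) _ _).symm))
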